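/- For real $\kappa\ge 1$ and $\sigma\in\mathbb R$ let $\|f\|_{H^\sigma_\kappa}^2=\int_{\mathbb R}(4\kappa^2+\xi^2)^\sigma|\hat f(\xi)|^2\,d\xi$, where $\hat f(\xi)=\frac1{\sqrt{2\pi}}\int_{\mathbb R} e^{-i\xi x}f(x)\,dx$, and let $H^\sigma=H^\sigma_1$. Consider the equations $$\text{(NLS)}\quad i\,\tfrac{d}{dt}q=-q''\pm2|q|^2q,\qquad\qquad \text{(mKdV)}\quad \tfrac{d}{dt}q=-q'''\pm6|q|^2q',$$ for $q:\mathbb R_t\times\mathbb R_x\to\mathbb C$, with either choice of sign. A Schwartz solution is a continuous curve $q:\mathbb R\to\mathscr S(\mathbb R)$, $t\mapsto q(t)$, satisfying the equation at every $(t,x)$. Let $0\le\sigma<\frac12$. Then there are constants $\delta_0>0$ and $C>0$, depending only on $\sigma$, such that the following hold for each of the two equations and each choice of sign. (i) For every $0<\delta\le\delta_0$ and every Schwartz solution $q$ with $\|q(0)\|_{L^2}\le\delta$, $$\|q(t)'\|_{H^{\sigma-1}_\kappa}^2\le C\Bigl(\|q(0)'\|_{H^{\sigma-1}_\kappa}^2+\kappa^{2\sigma-1}\delta^2\|q(0)\|_{L^2}^2\Bigr)\qquad\text{for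 all }t\in\mathbb R\text{ and }\kappa\ge1 .$$ (ii) Call a set $Q\subset\mathscr S(\mathbb R)$ equicontinuous in $H^\sigma$ if $\|q(\cdot+y)-q\|_{H^\sigma}\to0$ as $y\to0$, uniformly for $q\in Q$. If $Q\subset\{f\in\mathscr S(\mathbb R):\|f\|_{L^2}\le\delta_0\}$ is equicontinuous in $H^\sigma$, then so is the set of all $q(t)$ with $t\in\mathbb R$ and $q$ a Schwartz solution with $q(0)\in Q$. -/

import Mathlib

open scoped SchwartzMap

noncomputable section

namespace DispersiveFlows

/-- The Fourier transform `f̂(ξ) = (2π)^(-1/2) ∫ e^(-iξx) f(x) dx` on the line. -/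
def fourierHat (f : ℝ → ℂ) (ξ : ℝ) : ℂ :=
  ((1 / Real.sqrt (2 * Real.pi) : ℝ) : ℂ) *
    ∫ x : ℝ, Complex.exp (-(Complex.I * (ξ : ℂ) * (x : ℂ))) * f x

/-- The norm of `H^σ_κ(ℝ)`, given by
`‖f‖² = ∫ (4κ² + ξ²)^σ |f̂(ξ)|² dξ`.  It is only used for `κ ≥ 1` and Schwartz functions `f`,
for which the integrand is integrable. -/
def sobolevNorm (σ κ : ℝ) (f : ℝ → ℂ) : ℝ :=
  Real.sqrt (∫ ξ : ℝ, (4 * κ ^ 2 + ξ ^ 2) ^ σ * ‖fourierHat f ξ‖ ^ 2)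

/-- The `L²(ℝ)` norm of a Schwartz function. -/
def l2Norm (f : 𝓢(ℝ, ℂ)) : ℝ := ‖f.toLp 2 MeasureTheory.volume‖

/-- The two evolution equations under consideration. -/
inductive Equation where
  /-- the nonlinear Schroedinger equation -/
  | nls : Equation
  /-- the complex (Hirota) modified Korteweg-de Vries equation -/
  | mkdv : Equation

/-- The right-hand side of the equation, solved for `dq/dt`.  Here `ε = 1` is the defocusing and
`ε = -1` the focusing case:
* NLS: `i dq/dt = -q'' + 2ε|q|²q`, that is `dq/dt = -i(-q'' + 2ε|q|²q)`;
* mKdV: `dq/dt = -q''' + 6ε|q|²q'`. -/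
def Equation.vectorField (e : Equation) (ε : ℝ) (f : ℝ → ℂ) (x : ℝ) : ℂ :=
  match e with
  | .nls =>
      -Complex.I * (-iteratedDeriv 2 f x + 2 * (ε : ℂ) * ((‖f x‖ ^ 2 : ℝ) : ℂ) * f x)
  | .mkdv =>
      -iteratedDeriv 3 f x + 6 * (ε : ℂ) * ((‖f x‖ ^ 2 : ℝ) : ℂ) * deriv f x

/-- A global Schwartz solution: a continuous curve `t ↦ q(t)` in Schwartz space (with its usual
Fréchet topology) that satisfies the equation at every point of space-time. -/
structure IsSchwartzSolution (e : Equation) (ε : ℝ) (q : ℝ → 𝓢(ℝ, ℂ)) : Prop where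
  continuous : Continuous q
  hasDerivAt : ∀ t x : ℝ, HasDerivAt (fun τ : ℝ => q τ x) (e.vectorField ε (q t) x) t

/-- A set `Q` of Schwartz functions is equicontinuous in `H^σ = H^σ_1` if `q(· + y) → q` in `H^σ`
as `y → 0`, uniformly for `q ∈ Q`. -/
def EquicontinuousInSobolev (σ : ℝ) (Q : Set 𝓢(ℝ, ℂ)) : Prop :=
  ∀ η : ℝ, 0 < η → ∃ r : ℝ, 0 < r ∧
    ∀ f ∈ Q, ∀ y : ℝ, |y| < r → sobolevNorm σ 1 (fun x : ℝ => f (x + y) - f x) < η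

/-- All states reached, at any time, by Schwartz solutions with initial data in `Q`. -/
def orbits (e : Equation) (ε : ℝ) (Q : Set 𝓢(ℝ, ℂ)) : Set 𝓢(ℝ, ℂ) :=
  {f | ∃ (q : ℝ → 𝓢(ℝ, ℂ)) (t : ℝ), IsSchwartzSolution e ε q ∧ q 0 ∈ Q ∧ f = q t}

end DispersiveFlows

end

open scoped SchwartzMap FourierTransform BoundedContinuousFunction
open MeasureTheory Filter Topology

namespace DispersiveFlows

/-! ### Fourier transform, Plancherel and the resolvent on Schwartz functions -/

section Fourier

/-! Both equations are compatibility conditions of Lax pairs with the same spatial part. At an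
imaginary spectral parameter, the ratio `r` of the two components of a solution of the spatial
equation satisfies the Riccati equation `r' = -2κr + f - ε f̄ r²`, and `ε ∫ f̄ r` is the logarithm
of a transmission coefficient, hence should be conserved for every `κ`. The proof establishes this
directly, without scattering theory.

For small `‖f‖_{L²}` a contraction argument gives a bounded solution with `‖r‖_∞ ≤ ‖f‖_{L²}/√κ`
(`exists_isRiccati`). Bounded solutions of the linearized Riccati equation are stable
(`norm_le_of_linearized`), so any bounded solution of the equation obtained by formally
differentiating in time is the true time derivative of `r`
(`IsSchwartzSolution.hasDerivAt_riccati`). The temporal part of the Lax pair supplies such a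
solution (`Equation.riccatiField`), and with it the time derivative of `q̄ r` is an explicit
`x`-derivative (`IsRiccati.exists_flux`). Hence `∫ q̄ r` is conserved, as is the `L²` norm.

To leading order `r` is `(2κ + ∂)⁻¹ f`, so `‖f‖² - 2κ Re ∫ f̄ r` equals `∫ ξ²/(4κ² + ξ²) |f̂|² dξ`
up to an error `‖f‖⁴/κ` (`IsRiccati.abs_derivEnergy_sub_le`). This is the case `σ = 0`. For `0 < σ <
1/2` that estimate is integrated against `k^{2σ-1} dk` over `k > κ`: the multipliers average to one
comparable with `ξ² (4κ² + ξ²)^{σ-1}`, and the error `k^{2σ-2}` is integrable at infinity exactly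
because `σ < 1/2`.

Equicontinuity in `H^σ` of an `L²`-bounded set amounts to uniform smallness of these energies for
large `κ`. Since `κ^{2σ-1} → 0`, the bound (i) propagates this smallness in time. -/

theorem l2Norm_nonneg (f : 𝓢(ℝ, ℂ)) : 0 ≤ l2Norm f := norm_nonneg _

theorem l2Norm_sq (f : 𝓢(ℝ, ℂ)) : l2Norm f ^ 2 = ∫ x, ‖f x‖ ^ 2 := by
  have h := SchwartzMap.norm_toLp' (f := f) (p := 2) (μ := volume) (by simp) (by simp)
  simp only [ENNReal.toReal_ofNat, Real.rpow_ofNat] at h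
  rw [l2Norm, h, ← Real.rpow_natCast, ← Real.rpow_mul (by positivity)]
  simp

theorem integrable_norm_sq (f : 𝓢(ℝ, ℂ)) : Integrable fun x => ‖f x‖ ^ 2 := by
  simpa using (f.memLp 2 volume).integrable_norm_pow (by simp)

theorem fourierHat_eq (f : ℝ → ℂ) (ξ : ℝ) :
    fourierHat f ξ = ((1 / Real.sqrt (2 * Real.pi) : ℝ) : ℂ) * 𝓕 f (ξ / (2 * Real.pi)) := by
  rw [fourierHat, Real.fourier_real_eq_integral_exp_smul]
  congr 1
  refine integral_congr_ae (Eventually.of_forall fun x => ?_)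
  simp only [smul_eq_mul]
  congr 2
  have : (Real.pi : ℂ) ≠ 0 := by exact_mod_cast Real.pi_ne_zero
  push_cast
  field_simp

theorem norm_fourierHat_sq (f : ℝ → ℂ) (ξ : ℝ) :
    ‖fourierHat f ξ‖ ^ 2 = (2 * Real.pi)⁻¹ * ‖𝓕 f (ξ / (2 * Real.pi))‖ ^ 2 := by
  rw [fourierHat_eq, norm_mul, mul_pow, Complex.norm_real, Real.norm_eq_abs, sq_abs, div_pow,
    Real.sq_sqrt (by positivity), one_pow, one_div]

theorem integral_mul_norm_fourierHat_sq (W : ℝ → ℝ) (f : ℝ → ℂ) :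
    ∫ ξ, W ξ * ‖fourierHat f ξ‖ ^ 2 = ∫ w, W (2 * Real.pi * w) * ‖𝓕 f w‖ ^ 2 := by
  have hpi : (2 * Real.pi) ≠ 0 := by positivity
  have h := Measure.integral_comp_div (fun w => W (2 * Real.pi * w) * ‖𝓕 f w‖ ^ 2) (2 * Real.pi)
  rw [abs_of_pos (by positivity), smul_eq_mul] at h
  rw [← mul_right_inj' hpi, ← h, ← integral_const_mul]
  refine integral_congr_ae (Eventually.of_forall fun x => ?_)
  simp only [norm_fourierHat_sq, mul_div_cancel₀ _ hpi]
  field_simp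

theorem integral_norm_fourierHat_sq (f : 𝓢(ℝ, ℂ)) :
    ∫ ξ, ‖fourierHat f ξ‖ ^ 2 = l2Norm f ^ 2 := by
  have h := integral_mul_norm_fourierHat_sq (fun _ => 1) f
  simp only [one_mul] at h
  rw [h, l2Norm_sq, ← SchwartzMap.integral_norm_sq_fourier f]
  rfl

theorem continuous_fourierHat (f : 𝓢(ℝ, ℂ)) : Continuous (fourierHat f) := by
  have h : fourierHat f = fun ξ : ℝ =>
      ((1 / Real.sqrt (2 * Real.pi) : ℝ) : ℂ) * (𝓕 f : 𝓢(ℝ, ℂ)) (ξ / (2 * Real.pi)) :=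
    funext fun ξ => fourierHat_eq f ξ
  rw [h]
  exact continuous_const.mul ((𝓕 f : 𝓢(ℝ, ℂ)).continuous.comp (continuous_id.div_const _))

theorem integrable_norm_fourierHat_sq (f : 𝓢(ℝ, ℂ)) :
    Integrable fun ξ => ‖fourierHat f ξ‖ ^ 2 := by
  simp only [norm_fourierHat_sq]
  exact ((integrable_norm_sq (𝓕 f)).comp_div (R := 2 * Real.pi) (by positivity)).const_mul _

theorem fourierHat_deriv (f : 𝓢(ℝ, ℂ)) (ξ : ℝ) :
    fourierHat (deriv f) ξ = Complex.I * ξ * fourierHat f ξ := by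
  have h := Real.fourier_deriv (f := f) f.integrable f.differentiable
    (SchwartzMap.derivCLM ℂ ℂ f).integrable
  rw [fourierHat_eq, fourierHat_eq, h]
  have : (Real.pi : ℂ) ≠ 0 := by exact_mod_cast Real.pi_ne_zero
  simp only [smul_eq_mul]
  push_cast
  field_simp

theorem norm_fourierHat_deriv_sq (f : 𝓢(ℝ, ℂ)) (ξ : ℝ) :
    ‖fourierHat (deriv f) ξ‖ ^ 2 = ξ ^ 2 * ‖fourierHat f ξ‖ ^ 2 := by
  rw [fourierHat_deriv, norm_mul, norm_mul, Complex.norm_I, Complex.norm_real, Real.norm_eq_abs,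
    mul_pow, mul_pow, sq_abs]
  ring

theorem integrable_sq_mul_norm_fourierHat_sq (f : 𝓢(ℝ, ℂ)) :
    Integrable fun ξ => ξ ^ 2 * ‖fourierHat f ξ‖ ^ 2 := by
  simp only [← norm_fourierHat_deriv_sq]
  exact integrable_norm_fourierHat_sq (SchwartzMap.derivCLM ℂ ℂ f)

theorem integrable_mul_norm_fourierHat_sq {W : ℝ → ℝ} (hW : Measurable W) {C : ℝ}
    (h : ∀ ξ, |W ξ| ≤ C * (1 + ξ ^ 2)) (f : 𝓢(ℝ, ℂ)) :
    Integrable fun ξ => W ξ * ‖fourierHat f ξ‖ ^ 2 := by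
  refine (((integrable_norm_fourierHat_sq f).add
    (integrable_sq_mul_norm_fourierHat_sq f)).const_mul C).mono'
    (hW.mul ((continuous_fourierHat f).norm.pow 2).measurable).aestronglyMeasurable
    (Eventually.of_forall fun ξ => ?_)
  have h0 : 0 ≤ ‖fourierHat f ξ‖ ^ 2 := by positivity
  rw [Real.norm_eq_abs, abs_mul, abs_of_nonneg h0]
  calc _ ≤ C * (1 + ξ ^ 2) * ‖fourierHat f ξ‖ ^ 2 := mul_le_mul_of_nonneg_right (h ξ) h0
    _ = _ := by simp only [Pi.add_apply]; ring

theorem fourierHat_comp_add_sub (f : 𝓢(ℝ, ℂ)) (y ξ : ℝ) :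
    fourierHat (fun x => f (x + y) - f x) ξ =
      (Complex.exp (Complex.I * ξ * y) - 1) * fourierHat f ξ := by
  have hi : ∀ z, Integrable fun x : ℝ =>
      Complex.exp (-(Complex.I * (ξ : ℂ) * (x : ℂ))) * f (x + z) := fun z =>
    (f.integrable.comp_add_right z).bdd_mul (c := 1)
      (by fun_prop) (Eventually.of_forall fun x => by simp [Complex.norm_exp])
  have h1 : ∫ x : ℝ, Complex.exp (-(Complex.I * (ξ : ℂ) * (x : ℂ))) * f (x + y) =
      Complex.exp (Complex.I * ξ * y) *
        ∫ x : ℝ, Complex.exp (-(Complex.I * (ξ : ℂ) * (x : ℂ))) * f x := by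
    rw [← integral_const_mul, ← integral_add_right_eq_self (μ := volume) (fun x : ℝ =>
      Complex.exp (Complex.I * ξ * y) *
        (Complex.exp (-(Complex.I * (ξ : ℂ) * (x : ℂ))) * f x)) y]
    refine integral_congr_ae (Eventually.of_forall fun x => ?_)
    simp only [← mul_assoc, ← Complex.exp_add]
    congr 2
    push_cast
    ring
  have h0 := hi 0
  simp only [add_zero] at h0
  simp only [fourierHat, mul_sub]
  rw [integral_sub (hi y) h0, h1]
  ring

theorem norm_exp_I_mul_sub_one_sq (θ : ℝ) :
    ‖Complex.exp (Complex.I * θ) - 1‖ ^ 2 = 2 - 2 * Real.cos θ := by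
  rw [mul_comm, Complex.exp_mul_I, Complex.sq_norm, Complex.normSq_apply]
  simp only [Complex.sub_re, Complex.add_re, Complex.mul_re, Complex.I_re, Complex.I_im,
    Complex.sub_im, Complex.add_im, Complex.mul_im, Complex.one_re, Complex.one_im,
    Complex.cos_ofReal_re, Complex.sin_ofReal_re, Complex.cos_ofReal_im, Complex.sin_ofReal_im]
  nlinarith [Real.sin_sq_add_cos_sq θ]

theorem norm_fourierHat_comp_add_sub_sq (f : 𝓢(ℝ, ℂ)) (y ξ : ℝ) :
    ‖fourierHat (fun x => f (x + y) - f x) ξ‖ ^ 2 =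
      (2 - 2 * Real.cos (ξ * y)) * ‖fourierHat f ξ‖ ^ 2 := by
  rw [fourierHat_comp_add_sub, norm_mul, mul_pow, ← norm_exp_I_mul_sub_one_sq]
  push_cast
  rw [mul_assoc]

/-- Rationalizing the denominator leaves a linear factor times `(1 + (πw/κ)²)⁻¹`, a rescaled power
of the Japanese bracket. -/
theorem hasTemperateGrowth_inv_linear {κ : ℝ} (hκ : 0 < κ) :
    Function.HasTemperateGrowth fun w : ℝ => ((2 * κ : ℂ) - 2 * Real.pi * Complex.I * w)⁻¹ := by
  have h1 : Function.HasTemperateGrowth fun w : ℝ => (1 + ‖w‖ ^ 2) ^ (-1 : ℝ) :=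
    Function.hasTemperateGrowth_one_add_norm_sq_rpow ℝ (-1)
  have h2 : Function.HasTemperateGrowth fun w : ℝ => (Real.pi / κ) * w :=
    (Function.HasTemperateGrowth.const _).mul Function.HasTemperateGrowth.id'
  have h3 : Function.HasTemperateGrowth fun w : ℝ =>
      (((1 + ‖(Real.pi / κ) * w‖ ^ 2) ^ (-1 : ℝ) : ℝ) : ℂ) :=
    Function.Complex.hasTemperateGrowth_ofReal.comp (h1.comp h2)
  have h4 : Function.HasTemperateGrowth fun w : ℝ =>
      ((4 * κ ^ 2 : ℂ))⁻¹ * ((2 * κ : ℂ) + 2 * Real.pi * Complex.I * w) :=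
    (Function.HasTemperateGrowth.const _).mul ((Function.HasTemperateGrowth.const _).add
      ((Function.HasTemperateGrowth.const _).mul Function.Complex.hasTemperateGrowth_ofReal))
  refine (congrArg Function.HasTemperateGrowth (funext fun w => ?_)).mpr (h4.mul h3)
  have hκ' : (κ : ℂ) ≠ 0 := by exact_mod_cast hκ.ne'
  have h5 : (1 + ‖(Real.pi / κ) * w‖ ^ 2 : ℝ) ≠ 0 := by positivity
  have h6 : (2 * κ : ℂ) - 2 * Real.pi * Complex.I * w ≠ 0 := fun h => by
    have := congrArg Complex.re h
    simp at this
    exact hκ.ne' this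
  simp only [Pi.mul_apply]
  rw [Real.rpow_neg_one, Complex.ofReal_inv]
  have h7 : ((1 + ‖(Real.pi / κ) * w‖ ^ 2 : ℝ) : ℂ) * (4 * κ ^ 2) =
      ((2 * κ : ℂ) - 2 * Real.pi * Complex.I * w) *
        ((2 * κ : ℂ) + 2 * Real.pi * Complex.I * w) := by
    rw [Real.norm_eq_abs, sq_abs]
    push_cast
    field_simp
    linear_combination 4 * (Real.pi : ℂ) ^ 2 * w ^ 2 * Complex.I_sq
  have h8 : ((1 + ‖(Real.pi / κ) * w‖ ^ 2 : ℝ) : ℂ) ≠ 0 := by exact_mod_cast h5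
  generalize ((1 + ‖(Real.pi / κ) * w‖ ^ 2 : ℝ) : ℂ) = c at h7 h8 ⊢
  generalize (2 * κ : ℂ) - 2 * Real.pi * Complex.I * w = a at h6 h7 ⊢
  generalize (2 * κ : ℂ) + 2 * Real.pi * Complex.I * w = b at h7 ⊢
  have hb : b = a⁻¹ * (c * (4 * κ ^ 2)) := by rw [h7, inv_mul_cancel_left₀ h6]
  rw [hb]
  field_simp

/-- The resolvent `(2κ - ∂)⁻¹` acts on Schwartz functions. -/
theorem exists_resolvent {κ : ℝ} (hκ : 0 < κ) (f : 𝓢(ℝ, ℂ)) :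
    ∃ w : 𝓢(ℝ, ℂ), (∀ x, HasDerivAt w (2 * κ * w x - f x) x) ∧
      l2Norm w ≤ l2Norm f / (2 * κ) ∧
      (∫ x, (starRingEnd ℂ) (w x) * f x).re =
        ∫ ξ, 2 * κ / (4 * κ ^ 2 + ξ ^ 2) * ‖fourierHat f ξ‖ ^ 2 := by
  have hg := hasTemperateGrowth_inv_linear hκ
  set g : ℝ → ℂ := fun w => ((2 * κ : ℂ) - 2 * Real.pi * Complex.I * w)⁻¹ with hgdef
  have hne : ∀ w : ℝ, (2 * κ : ℂ) - 2 * Real.pi * Complex.I * w ≠ 0 := fun w h => by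
    have := congrArg Complex.re h
    simp at this
    exact hκ.ne' this
  obtain ⟨w, hw⟩ : ∃ w : 𝓢(ℝ, ℂ), 𝓕 w = SchwartzMap.smulLeftCLM ℂ g (𝓕 f) :=
    ⟨𝓕⁻ (SchwartzMap.smulLeftCLM ℂ g (𝓕 f)), by simp⟩
  have hwx : ∀ ξ, (𝓕 w : 𝓢(ℝ, ℂ)) ξ = g ξ * (𝓕 f : 𝓢(ℝ, ℂ)) ξ := fun ξ => by
    rw [hw, SchwartzMap.smulLeftCLM_apply_apply hg, smul_eq_mul]
  have hns : ∀ ξ : ℝ, ‖g ξ‖ ^ 2 = (4 * κ ^ 2 + (2 * Real.pi * ξ) ^ 2)⁻¹ := fun ξ => by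
    rw [hgdef]
    simp only [norm_inv, inv_pow]
    rw [Complex.sq_norm, Complex.normSq_apply]
    simp
    ring
  refine ⟨w, ?_, ?_, ?_⟩
  · have key : (2 * κ : ℂ) • w - SchwartzMap.derivCLM ℂ ℂ w = f := by
      apply (FourierTransform.fourierCLE ℂ 𝓢(ℝ, ℂ)).injective
      rw [map_sub, map_smul]
      simp only [FourierTransform.fourierCLE_apply]
      ext ξ
      have h1 : (𝓕 (SchwartzMap.derivCLM ℂ ℂ w) : 𝓢(ℝ, ℂ)) ξ =
          2 * Real.pi * Complex.I * ξ * (𝓕 w : 𝓢(ℝ, ℂ)) ξ := by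
        have h := Real.fourier_deriv (f := w) w.integrable w.differentiable
          (SchwartzMap.derivCLM ℂ ℂ w).integrable
        exact congrFun h ξ
      simp only [sub_apply, smul_apply, smul_eq_mul]
      rw [h1, hwx, ← mul_assoc, ← mul_assoc, ← sub_mul, ← sub_mul, mul_inv_cancel₀ (hne ξ), one_mul]
    intro x
    have hd := w.hasDerivAt x
    have hk : 2 * κ * w x - deriv w x = f x := by
      simpa using congrArg (fun u : 𝓢(ℝ, ℂ) => u x) key
    rwa [← hk, sub_sub_cancel]
  · refine le_of_sq_le_sq ?_ (by have := l2Norm_nonneg f; positivity)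
    rw [div_pow, l2Norm_sq, l2Norm_sq, ← SchwartzMap.integral_norm_sq_fourier,
      ← SchwartzMap.integral_norm_sq_fourier f, ← integral_div]
    refine integral_mono (integrable_norm_sq _) ((integrable_norm_sq _).div_const _) fun ξ => ?_
    simp only [hwx, norm_mul, mul_pow, hns]
    rw [div_eq_inv_mul]
    gcongr
    nlinarith [sq_nonneg (2 * Real.pi * ξ)]
  · have h1 : ∫ x, (starRingEnd ℂ) (w x) * f x = ∫ x, inner ℂ (w x) (f x) := by
      simp [mul_comm]
    rw [h1, ← SchwartzMap.integral_inner_fourier_fourier,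
      integral_mul_norm_fourierHat_sq (fun ξ => 2 * κ / (4 * κ ^ 2 + ξ ^ 2)) f]
    have h2 : Integrable fun ξ => inner ℂ ((𝓕 w : 𝓢(ℝ, ℂ)) ξ) ((𝓕 f : 𝓢(ℝ, ℂ)) ξ) :=
      ((𝓕 f : 𝓢(ℝ, ℂ)).memLp 2 volume).integrable_mul
        (((𝓕 w : 𝓢(ℝ, ℂ)).memLp 2 volume).star) |>.congr
        (Eventually.of_forall fun x => by simp)
    have h3 := integral_re h2
    simp only [RCLike.re_to_complex] at h3
    rw [← h3]
    refine integral_congr_ae (Eventually.of_forall fun ξ => ?_)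
    -- As `g = 1/(2κ - 2πiξ)`, its real part is `2κ|g|²`; this turns the inner product into the
    -- positive multiplier in the claim.
    have h4 : (g ξ).re = 2 * κ * ‖g ξ‖ ^ 2 := by
      rw [hns]
      simp only [hgdef, Complex.inv_re, Complex.normSq_apply]
      simp
      ring
    have h5 : (inner ℂ ((𝓕 w : 𝓢(ℝ, ℂ)) ξ) ((𝓕 f : 𝓢(ℝ, ℂ)) ξ)).re =
        (g ξ).re * ‖(𝓕 f : 𝓢(ℝ, ℂ)) ξ‖ ^ 2 := by
      rw [hwx, Complex.sq_norm, Complex.normSq_apply]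
      simp
      ring
    simp only
    rw [h5, h4, hns, SchwartzMap.fourier_coe, ← div_eq_mul_inv]

end Fourier

/-! ### Bounded solutions of the linear equation `E' = -2κE + F` -/

section LinearEquation

theorem integrableOn_exp_mul_Iic_of_bounded {κ : ℝ} (hκ : 0 < κ) {F : ℝ → ℂ} (hF : Continuous F)
    {C : ℝ} (hC : ∀ x, ‖F x‖ ≤ C) (x : ℝ) :
    IntegrableOn (fun y : ℝ => ((Real.exp (2 * κ * y) : ℝ) : ℂ) * F y) (Set.Iic x) := by
  refine ((integrableOn_exp_mul_Iic (a := 2 * κ) (by positivity) x).mul_const C).mono'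
    (Continuous.aestronglyMeasurable (by fun_prop)) (Eventually.of_forall fun y => ?_)
  rw [norm_mul, Complex.norm_real, Real.norm_eq_abs, abs_of_pos (Real.exp_pos _)]
  exact mul_le_mul_of_nonneg_left (hC y) (Real.exp_pos _).le

/-- Cauchy–Schwarz against the weight, whose `L²` norm on `(-∞, x]` is `e^{2κx}/(2√κ)`. This gain of
`κ^{-1/2}` is what makes `L²` smallness alone sufficient. -/
theorem integral_exp_mul_norm_le {κ : ℝ} (hκ : 0 < κ) (f : 𝓢(ℝ, ℂ)) (x : ℝ) :
    ∫ y in Set.Iic x, Real.exp (2 * κ * y) * ‖f y‖ ≤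
      Real.exp (2 * κ * x) * (l2Norm f / (2 * Real.sqrt κ)) := by
  have hsq : ∀ y : ℝ, Real.exp (2 * κ * y) ^ (2 : ℝ) = Real.exp (4 * κ * y) := fun y => by
    rw [Real.rpow_two, sq, ← Real.exp_add]; ring_nf
  have h1 : MemLp (fun y : ℝ => Real.exp (2 * κ * y)) (ENNReal.ofReal 2)
      (volume.restrict (Set.Iic x)) := by
    have h := (memLp_two_iff_integrable_sq (μ := volume.restrict (Set.Iic x))
      (f := fun y : ℝ => Real.exp (2 * κ * y)) (Continuous.aestronglyMeasurable (by fun_prop))).2 (by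
        simp only [← Real.rpow_two, hsq]
        exact integrableOn_exp_mul_Iic (by positivity) x)
    simpa using h
  have h2 : MemLp (fun y : ℝ => ‖f y‖) (ENNReal.ofReal 2) (volume.restrict (Set.Iic x)) := by
    simpa using ((f.memLp 2 volume).restrict (Set.Iic x)).norm
  have h := integral_mul_le_Lp_mul_Lq_of_nonneg (μ := volume.restrict (Set.Iic x))
    Real.HolderConjugate.two_two (Eventually.of_forall fun y => (Real.exp_pos (2 * κ * y)).le)
    (Eventually.of_forall fun y => norm_nonneg (f y)) h1 h2
  refine h.trans ?_
  simp only [hsq]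
  rw [integral_exp_mul_Iic (by positivity), ← Real.sqrt_eq_rpow, ← Real.sqrt_eq_rpow]
  have h3 : Real.sqrt (Real.exp (4 * κ * x) / (4 * κ)) =
      Real.exp (2 * κ * x) / (2 * Real.sqrt κ) := by
    rw [Real.sqrt_eq_iff_mul_self_eq (by positivity) (by positivity), ← hsq, Real.rpow_two]
    have := Real.mul_self_sqrt hκ.le
    field_simp
    nlinarith
  have h4 : Real.sqrt (∫ y in Set.Iic x, ‖f y‖ ^ (2 : ℝ)) ≤ l2Norm f := by
    refine Real.sqrt_le_iff.2 ⟨l2Norm_nonneg f, ?_⟩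
    simp only [Real.rpow_two]
    rw [l2Norm_sq]
    exact setIntegral_le_integral (integrable_norm_sq f)
      (Eventually.of_forall fun y => by positivity)
  rw [h3]
  calc _ ≤ Real.exp (2 * κ * x) / (2 * Real.sqrt κ) * l2Norm f := by gcongr
    _ = _ := by ring

theorem hasDerivAt_exp_mul {κ : ℝ} {E F : ℝ → ℂ} {x : ℝ}
    (hE : HasDerivAt E (-(2 * κ) * E x + F x) x) :
    HasDerivAt (fun y : ℝ => ((Real.exp (2 * κ * y) : ℝ) : ℂ) * E y)
      (((Real.exp (2 * κ * x) : ℝ) : ℂ) * F x) x := by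
  have h1 : HasDerivAt (fun y : ℝ => Real.exp (2 * κ * y)) (Real.exp (2 * κ * x) * (2 * κ)) x := by
    simpa using ((hasDerivAt_id x).const_mul (2 * κ)).exp
  refine (h1.ofReal_comp.mul hE).congr_deriv ?_
  push_cast
  ring

/-- The bounded solution of `E' = -2κE + F` is controlled by the forcing term. -/
theorem norm_le_of_hasDerivAt_linear {κ : ℝ} (hκ : 0 < κ) (f : 𝓢(ℝ, ℂ)) {E F : ℝ → ℂ} {B D M : ℝ}
    (hE : ∀ x, HasDerivAt E (-(2 * κ) * E x + F x) x) (hFc : Continuous F)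
    (hM : ∀ x, ‖E x‖ ≤ M) (hB : 0 ≤ B) (hF : ∀ x, ‖F x‖ ≤ B * ‖f x‖ + D) (x : ℝ) :
    ‖E x‖ ≤ B * (l2Norm f / (2 * Real.sqrt κ)) + D / (2 * κ) := by
  obtain ⟨K, hK⟩ : ∃ K, ∀ y, ‖f y‖ ≤ K := ⟨_, fun y => SchwartzMap.norm_le_seminorm ℝ f y⟩
  have hint := integrableOn_exp_mul_Iic_of_bounded hκ hFc (C := B * K + D)
    (fun y => (hF y).trans (by gcongr; exact hK y)) x
  -- Boundedness of `E` removes the boundary term at `-∞`, so `e^{2κx}E(x)` is exactly the integral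
  -- of the forcing. With `F = 0` this also shows uniqueness of bounded solutions.
  have hlim : Tendsto (fun y : ℝ => ((Real.exp (2 * κ * y) : ℝ) : ℂ) * E y) atBot (𝓝 0) := by
    have h0 : Tendsto (fun y : ℝ => Real.exp (2 * κ * y) * M) atBot (𝓝 0) := by
      have : Tendsto (fun y : ℝ => 2 * κ * y) atBot atBot :=
        tendsto_id.const_mul_atBot (by positivity)
      simpa using (Real.tendsto_exp_atBot.comp this).mul_const M
    refine squeeze_zero_norm (fun y => ?_) h0
    rw [norm_mul, Complex.norm_real, Real.norm_eq_abs, abs_of_pos (Real.exp_pos _)]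
    exact mul_le_mul_of_nonneg_left (hM y) (Real.exp_pos _).le
  have hd := fun y => hasDerivAt_exp_mul (hE y)
  have hFTC := integral_Iic_of_hasDerivAt_of_tendsto (hd x).continuousAt.continuousWithinAt
    (fun y _ => hd y) hint hlim
  rw [sub_zero] at hFTC
  have hfi : IntegrableOn (fun y => Real.exp (2 * κ * y) * ‖f y‖) (Set.Iic x) := by
    have := (integrableOn_exp_mul_Iic_of_bounded hκ f.continuous hK x).norm
    refine this.congr (Eventually.of_forall fun y => ?_)
    simp only [norm_mul, Complex.norm_real, Real.norm_eq_abs, abs_of_pos (Real.exp_pos _)]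
  have hei := integrableOn_exp_mul_Iic (a := 2 * κ) (by positivity) x
  have h1 : Real.exp (2 * κ * x) * ‖E x‖ ≤
      ∫ y in Set.Iic x, (B * (Real.exp (2 * κ * y) * ‖f y‖) + D * Real.exp (2 * κ * y)) := by
    calc Real.exp (2 * κ * x) * ‖E x‖ = ‖((Real.exp (2 * κ * x) : ℝ) : ℂ) * E x‖ := by
          rw [norm_mul, Complex.norm_real, Real.norm_eq_abs, abs_of_pos (Real.exp_pos _)]
      _ ≤ ∫ y in Set.Iic x, ‖((Real.exp (2 * κ * y) : ℝ) : ℂ) * F y‖ := by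
          rw [← hFTC]; exact norm_integral_le_integral_norm _
      _ ≤ _ := by
          refine integral_mono hint.norm ((hfi.const_mul B).add (hei.const_mul D)) fun y => ?_
          simp only [norm_mul, Complex.norm_real, Real.norm_eq_abs, abs_of_pos (Real.exp_pos _)]
          nlinarith [mul_le_mul_of_nonneg_left (hF y) (Real.exp_pos (2 * κ * y)).le]
  rw [integral_add (hfi.const_mul B) (hei.const_mul D), integral_const_mul, integral_const_mul,
    integral_exp_mul_Iic (by positivity)] at h1
  have h2 := mul_le_mul_of_nonneg_left (integral_exp_mul_norm_le hκ f x) hB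
  refine le_of_mul_le_mul_left ?_ (Real.exp_pos (2 * κ * x))
  calc _ ≤ _ := h1
    _ ≤ _ := add_le_add_left h2 _
    _ = _ := by ring

/-- The bounded solution of `E' = -2κE + F`. -/
noncomputable def resolventMap (κ : ℝ) (F : ℝ → ℂ) (x : ℝ) : ℂ :=
  ((Real.exp (-(2 * κ * x)) : ℝ) : ℂ) *
    ∫ y in Set.Iic x, ((Real.exp (2 * κ * y) : ℝ) : ℂ) * F y

theorem hasDerivAt_resolventMap {κ : ℝ} (hκ : 0 < κ) (F : ℝ →ᵇ ℂ) (x : ℝ) :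
    HasDerivAt (resolventMap κ F) (-(2 * κ) * resolventMap κ F x + F x) x := by
  have hint := integrableOn_exp_mul_Iic_of_bounded hκ F.continuous F.norm_coe_le_norm
  have hc : Continuous fun y : ℝ => ((Real.exp (2 * κ * y) : ℝ) : ℂ) * F y := by fun_prop
  have h1 : HasDerivAt (fun u => ∫ y in Set.Iic u, ((Real.exp (2 * κ * y) : ℝ) : ℂ) * F y)
      (((Real.exp (2 * κ * x) : ℝ) : ℂ) * F x) x := by
    have h2 := (hc.integral_hasStrictDerivAt 0 x).hasDerivAt.const_add
      (∫ y in Set.Iic 0, ((Real.exp (2 * κ * y) : ℝ) : ℂ) * F y)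
    refine h2.congr_of_eventuallyEq (Eventually.of_forall fun u => ?_)
    simp only
    rw [← intervalIntegral.integral_Iic_sub_Iic (hint 0) (hint u), add_sub_cancel]
  have h3 : HasDerivAt (fun y : ℝ => Real.exp (-(2 * κ * y)))
      (Real.exp (-(2 * κ * x)) * (-(2 * κ))) x := by
    simpa using ((hasDerivAt_id x).const_mul (2 * κ)).neg.exp
  refine (h3.ofReal_comp.mul h1).congr_deriv ?_
  have h4 : ((Real.exp (-(2 * κ * x)) : ℝ) : ℂ) * ((Real.exp (2 * κ * x) : ℝ) : ℂ) = 1 := by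
    rw [← Complex.ofReal_mul, ← Real.exp_add]; simp
  rw [resolventMap]
  push_cast at h4 ⊢
  linear_combination F x * h4

theorem norm_resolventMap_le {κ : ℝ} (hκ : 0 < κ) (F : ℝ →ᵇ ℂ) (x : ℝ) :
    ‖resolventMap κ F x‖ ≤ ‖F‖ / (2 * κ) := by
  have hint := integrableOn_exp_mul_Iic_of_bounded hκ F.continuous F.norm_coe_le_norm x
  rw [resolventMap, norm_mul, Complex.norm_real, Real.norm_eq_abs, abs_of_pos (Real.exp_pos _)]
  have h1 : ‖∫ y in Set.Iic x, ((Real.exp (2 * κ * y) : ℝ) : ℂ) * F y‖ ≤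
      Real.exp (2 * κ * x) / (2 * κ) * ‖F‖ := by
    rw [← integral_exp_mul_Iic (by positivity), ← integral_mul_const]
    refine (norm_integral_le_integral_norm _).trans (integral_mono hint.norm
      ((integrableOn_exp_mul_Iic (by positivity) x).mul_const _) fun y => ?_)
    simp only [norm_mul, Complex.norm_real, Real.norm_eq_abs, abs_of_pos (Real.exp_pos _)]
    exact mul_le_mul_of_nonneg_left (F.norm_coe_le_norm y) (Real.exp_pos _).le
  calc _ ≤ Real.exp (-(2 * κ * x)) * (Real.exp (2 * κ * x) / (2 * κ) * ‖F‖) := by gcongr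
    _ = (Real.exp (-(2 * κ * x)) * Real.exp (2 * κ * x)) * (‖F‖ / (2 * κ)) := by ring
    _ = _ := by rw [← Real.exp_add]; simp

/-- `resolventMap` on bounded continuous functions. -/
noncomputable def resolventBCF {κ : ℝ} (hκ : 0 < κ) (F : ℝ →ᵇ ℂ) : ℝ →ᵇ ℂ :=
  BoundedContinuousFunction.ofNormedAddCommGroup (resolventMap κ F)
    (continuous_iff_continuousAt.2 fun x => (hasDerivAt_resolventMap hκ F x).continuousAt)
    (‖F‖ / (2 * κ)) (norm_resolventMap_le hκ F)

theorem hasDerivAt_resolventBCF {κ : ℝ} (hκ : 0 < κ) (F : ℝ →ᵇ ℂ) (x : ℝ) :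
    HasDerivAt (resolventBCF hκ F) (-(2 * κ) * resolventBCF hκ F x + F x) x :=
  hasDerivAt_resolventMap hκ F x

end LinearEquation

/-! ### Small solutions of the Riccati equation and their stability -/

section Riccati

/-- A small bounded solution of the Riccati equation `r' = -2κr + f - ε f̄ r²`. -/
structure IsRiccati (κ ε : ℝ) (f : 𝓢(ℝ, ℂ)) (r : ℝ →ᵇ ℂ) : Prop where
  norm_le : ‖r‖ ≤ l2Norm f / Real.sqrt κ
  hasDerivAt : ∀ x, HasDerivAt r
    (-(2 * κ) * r x + (f x - ε * (starRingEnd ℂ) (f x) * r x ^ 2)) x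

theorem l2Norm_div_sqrt_le {κ : ℝ} (hκ : 1 ≤ κ) {f : 𝓢(ℝ, ℂ)} (hf : l2Norm f ≤ 1 / 2) :
    l2Norm f / Real.sqrt κ ≤ 1 / 2 :=
  (div_le_self (l2Norm_nonneg f) (Real.one_le_sqrt.2 hκ)).trans hf

/-- Fixed point of `r ↦ (2κ + ∂)⁻¹(f - ε f̄ r²)` on the sup-norm ball of radius `R = ‖f‖/√κ ≤ 1/2`.
The linear bound gives norm at most `(1 + R²)R/2 ≤ R` and Lipschitz constant `2R · R/2 = R² ≤ 1/4`.
-/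
theorem exists_isRiccati {κ ε : ℝ} (hκ : 1 ≤ κ) (hε : ‖(ε : ℂ)‖ = 1) (f : 𝓢(ℝ, ℂ))
    (hf : l2Norm f ≤ 1 / 2) : ∃ r, IsRiccati κ ε f r := by
  have hκ0 : 0 < κ := by linarith
  set R := l2Norm f / Real.sqrt κ with hR
  have hR0 : 0 ≤ R := div_nonneg (l2Norm_nonneg f) (Real.sqrt_nonneg _)
  have hR1 : R ≤ 1 / 2 := l2Norm_div_sqrt_le hκ hf
  have hR2 : l2Norm f / (2 * Real.sqrt κ) = R / 2 := by rw [hR]; ring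
  let fb : ℝ →ᵇ ℂ := f.toBoundedContinuousFunction
  let N : (ℝ →ᵇ ℂ) → (ℝ →ᵇ ℂ) := fun r => fb - (ε : ℂ) • (star fb * (r * r))
  have hN : ∀ r x, N r x = f x - ε * (starRingEnd ℂ) (f x) * r x ^ 2 := fun r x => by
    simp [N, fb]
    ring
  have hball : ∀ r ∈ Metric.closedBall (0 : ℝ →ᵇ ℂ) R, ∀ x, ‖r x‖ ≤ R := fun r hr x =>
    (r.norm_coe_le_norm x).trans (by simpa using hr)
  have hmaps : Set.MapsTo (fun r => resolventBCF hκ0 (N r)) (Metric.closedBall 0 R)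
      (Metric.closedBall 0 R) := by
    intro r hr
    rw [mem_closedBall_zero_iff, BoundedContinuousFunction.norm_le hR0]
    intro x
    refine (norm_le_of_hasDerivAt_linear hκ0 f (B := 1 + R ^ 2) (D := 0)
      (hasDerivAt_resolventBCF hκ0 (N r)) (N r).continuous
      (resolventBCF hκ0 (N r)).norm_coe_le_norm (by positivity) (fun y => ?_) x).trans ?_
    · rw [hN]
      refine (norm_sub_le _ _).trans ?_
      rw [norm_mul, norm_mul, norm_pow, hε, RCLike.norm_conj]
      have := pow_le_pow_left₀ (norm_nonneg _) (hball r hr y) 2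
      nlinarith [norm_nonneg (f y)]
    · rw [hR2, zero_div, add_zero]
      nlinarith [mul_le_mul hR1 hR1 hR0 (by norm_num)]
  have hlip : ContractingWith (1 / 4) (hmaps.restrict _ _ _) := by
    refine ⟨by rw [← NNReal.coe_lt_coe]; norm_num, LipschitzWith.of_dist_le_mul fun r₁ r₂ => ?_⟩
    obtain ⟨r₁, h₁⟩ := r₁
    obtain ⟨r₂, h₂⟩ := r₂
    rw [Subtype.dist_eq, Subtype.dist_eq]
    simp only [Set.MapsTo.val_restrict_apply]
    rw [BoundedContinuousFunction.dist_le (by positivity)]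
    intro x
    rw [dist_eq_norm]
    have hd : ∀ x, HasDerivAt (fun x => resolventBCF hκ0 (N r₁) x - resolventBCF hκ0 (N r₂) x)
        (-(2 * κ) * (resolventBCF hκ0 (N r₁) x - resolventBCF hκ0 (N r₂) x) +
          (N r₁ x - N r₂ x)) x := fun x =>
      ((hasDerivAt_resolventBCF hκ0 (N r₁) x).sub
        (hasDerivAt_resolventBCF hκ0 (N r₂) x)).congr_deriv (by ring)
    refine (norm_le_of_hasDerivAt_linear hκ0 f (B := 2 * R * dist r₁ r₂) (D := 0)
      hd ((N r₁).continuous.sub (N r₂).continuous)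
      (resolventBCF hκ0 (N r₁) - resolventBCF hκ0 (N r₂)).norm_coe_le_norm
      (by positivity) (fun y => ?_) x).trans ?_
    · rw [hN, hN]
      have : f y - ε * (starRingEnd ℂ) (f y) * r₁ y ^ 2 -
          (f y - ε * (starRingEnd ℂ) (f y) * r₂ y ^ 2) =
          -(ε * (starRingEnd ℂ) (f y) * ((r₁ y + r₂ y) * (r₁ y - r₂ y))) := by ring
      rw [this, norm_neg, norm_mul, norm_mul, norm_mul, hε, RCLike.norm_conj, add_zero, one_mul,
        mul_comm]
      have h3 : ‖r₁ y + r₂ y‖ ≤ 2 * R := by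
        have := norm_add_le (r₁ y) (r₂ y)
        linarith [hball r₁ h₁ y, hball r₂ h₂ y]
      have h4 : ‖r₁ y - r₂ y‖ ≤ dist r₁ r₂ := by
        rw [← dist_eq_norm]; exact BoundedContinuousFunction.dist_coe_le_dist y
      gcongr
    · rw [hR2]
      simp only [zero_div, add_zero, NNReal.coe_div, NNReal.coe_one, NNReal.coe_ofNat]
      have : R * R ≤ 1 / 4 := by nlinarith
      nlinarith [dist_nonneg (x := r₁) (y := r₂)]
  obtain ⟨r, hr, hfix, -⟩ := ContractingWith.exists_fixedPoint'
    (Metric.isClosed_closedBall.isComplete) hmaps hlip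
    (Metric.mem_closedBall_self hR0) (edist_ne_top _ _)
  refine ⟨r, by simpa using hr, fun x => ?_⟩
  have h := hasDerivAt_resolventBCF hκ0 (N r) x
  rw [hN] at h
  rwa [show resolventBCF hκ0 (N r) = r from hfix] at h

/-- Uniform stability of bounded solutions of the linearized Riccati equation. -/
theorem norm_le_of_linearized {κ ε : ℝ} (hκ : 1 ≤ κ) (hε : ‖(ε : ℂ)‖ = 1) {f : 𝓢(ℝ, ℂ)}
    (hf : l2Norm f ≤ 1 / 2) {m E g : ℝ →ᵇ ℂ} (hm : ‖m‖ ≤ 1)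
    (hE : ∀ x, HasDerivAt E
      (-(2 * κ) * E x + (g x - ε * (starRingEnd ℂ) (f x) * (m x * E x))) x) :
    ‖E‖ ≤ ‖g‖ := by
  have hκ0 : 0 < κ := by linarith
  have h1 : ∀ x, ‖E x‖ ≤ ‖E‖ * (l2Norm f / (2 * Real.sqrt κ)) + ‖g‖ / (2 * κ) :=
    norm_le_of_hasDerivAt_linear hκ0 f hE
      (by have := f.continuous; have := Complex.continuous_conj; fun_prop)
      E.norm_coe_le_norm (norm_nonneg _) fun x => by
        refine (norm_sub_le _ _).trans ?_
        rw [norm_mul, norm_mul, norm_mul, hε, RCLike.norm_conj, one_mul, add_comm]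
        have h2 := m.norm_coe_le_norm x
        have h3 : ‖m x‖ * ‖E x‖ ≤ 1 * ‖E‖ :=
          mul_le_mul (h2.trans hm) (E.norm_coe_le_norm x) (norm_nonneg _) zero_le_one
        have := mul_le_mul_of_nonneg_left h3 (norm_nonneg (f x))
        linarith [g.norm_coe_le_norm x]
  have h2 : ‖E‖ ≤ ‖E‖ * (l2Norm f / (2 * Real.sqrt κ)) + ‖g‖ / (2 * κ) :=
    (BoundedContinuousFunction.norm_le ((norm_nonneg _).trans (h1 0))).2 h1
  have h3 : l2Norm f / (2 * Real.sqrt κ) = l2Norm f / Real.sqrt κ / 2 := by ring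
  have h4 := l2Norm_div_sqrt_le hκ hf
  have h5 : ‖g‖ / (2 * κ) ≤ ‖g‖ / 2 := by
    gcongr
    linarith
  rw [h3] at h2
  -- The inequality now reads `‖E‖ ≤ ‖E‖/4 + ‖g‖/2`, so the first term is absorbed.
  nlinarith [norm_nonneg E]

end Riccati

/-! ### Derivatives and vector fields as bounded continuous functions -/

section Jets

/-- The `k`-th derivative of a Schwartz function, as a bounded continuous function. -/
noncomputable def jet (k : ℕ) (f : 𝓢(ℝ, ℂ)) : ℝ →ᵇ ℂ :=
  ((SchwartzMap.derivCLM ℂ ℂ)^[k] f).toBoundedContinuousFunction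

theorem jet_zero_apply (f : 𝓢(ℝ, ℂ)) (x : ℝ) : jet 0 f x = f x := rfl

theorem continuous_iterate_derivCLM (k : ℕ) :
    Continuous fun f : 𝓢(ℝ, ℂ) => (SchwartzMap.derivCLM ℂ ℂ)^[k] f :=
  (SchwartzMap.derivCLM ℂ ℂ).continuous.iterate k

@[fun_prop]
theorem continuous_jet (k : ℕ) : Continuous (jet k) :=
  (SchwartzMap.toBoundedContinuousFunctionCLM ℂ ℝ ℂ).continuous.comp
    (continuous_iterate_derivCLM k)

theorem hasDerivAt_jet (k : ℕ) (f : 𝓢(ℝ, ℂ)) (x : ℝ) :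
    HasDerivAt (jet k f) (jet (k + 1) f x) x := by
  have h := ((SchwartzMap.derivCLM ℂ ℂ)^[k] f).hasDerivAt x
  refine h.congr_deriv ?_
  simp [jet, Function.iterate_succ_apply']

theorem hasDerivAt_conj_jet (k : ℕ) (f : 𝓢(ℝ, ℂ)) (x : ℝ) :
    HasDerivAt (fun y => (starRingEnd ℂ) (jet k f y)) ((starRingEnd ℂ) (jet (k + 1) f x)) x :=
  (hasDerivAt_jet k f x).star

theorem jet_eq_iteratedDeriv (k : ℕ) (f : 𝓢(ℝ, ℂ)) : (jet k f : ℝ → ℂ) = iteratedDeriv k f := by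
  induction k with
  | zero => rfl
  | succ k ih =>
    rw [iteratedDeriv_succ, ← ih]
    exact funext fun x => (hasDerivAt_jet k f x).deriv.symm

theorem integrable_jet (k : ℕ) (f : 𝓢(ℝ, ℂ)) : Integrable (jet k f) :=
  ((SchwartzMap.derivCLM ℂ ℂ)^[k] f).integrable

/-- Each term of every flux and density below carries a conjugated Schwartz factor, so mere
boundedness of `r`, with no decay, suffices for integrability. -/
theorem integrable_conj_jet_mul (k : ℕ) (f : 𝓢(ℝ, ℂ)) (u : ℝ →ᵇ ℂ) :
    Integrable fun x => (starRingEnd ℂ) (jet k f x) * u x := by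
  have h : Integrable fun x => (starRingEnd ℂ) (jet k f x) :=
    (integrable_jet k f).norm.mono' (Complex.continuous_conj.comp
      (jet k f).continuous).aestronglyMeasurable (Eventually.of_forall fun x => by simp)
  exact h.mul_bdd (c := ‖u‖) u.continuous.aestronglyMeasurable
    (Eventually.of_forall u.norm_coe_le_norm)

/-- Continuity of `K` on Schwartz space makes the decay locally uniform in time along a solution, as
needed to differentiate under the integral. -/
theorem exists_decay_jet (k : ℕ) : ∃ K : 𝓢(ℝ, ℂ) → ℝ, Continuous K ∧
    (∀ f, 0 ≤ K f) ∧ ∀ f x, ‖jet k f x‖ ≤ K f / (1 + x ^ 2) := by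
  have hg : Function.HasTemperateGrowth fun x : ℝ => (1 : ℝ) + x ^ 2 :=
    (Function.HasTemperateGrowth.const (1 : ℝ)).add (Function.HasTemperateGrowth.id'.pow 2)
  refine ⟨fun f => ‖SchwartzMap.toBoundedContinuousFunctionCLM ℝ ℝ ℂ
    (SchwartzMap.smulLeftCLM ℂ (fun x : ℝ => (1 : ℝ) + x ^ 2)
      ((SchwartzMap.derivCLM ℂ ℂ)^[k] f))‖, ?_, fun f => norm_nonneg _, fun f x => ?_⟩
  · exact ((SchwartzMap.toBoundedContinuousFunctionCLM ℝ ℝ ℂ).continuous.comp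
      ((SchwartzMap.smulLeftCLM ℂ _).continuous.comp (continuous_iterate_derivCLM k))).norm
  · rw [le_div_iff₀ (by positivity)]
    refine le_trans (le_of_eq ?_) (BoundedContinuousFunction.norm_coe_le_norm _ x)
    rw [SchwartzMap.toBoundedContinuousFunctionCLM_apply,
      SchwartzMap.smulLeftCLM_apply_apply hg, norm_smul, Real.norm_eq_abs,
      abs_of_pos (by positivity), mul_comm]
    rfl

theorem norm_ofReal_of_eq {ε : ℝ} (hε : ε = 1 ∨ ε = -1) : ‖(ε : ℂ)‖ = 1 := by
  rcases hε with rfl | rfl <;> simp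

/-- The vector field of the equation, as a bounded continuous function. -/
noncomputable def Equation.field (e : Equation) (ε : ℝ) (f : 𝓢(ℝ, ℂ)) : ℝ →ᵇ ℂ :=
  match e with
  | .nls => (-Complex.I) • (-jet 2 f + (2 * ε : ℂ) • (star (jet 0 f) * jet 0 f * jet 0 f))
  | .mkdv => -jet 3 f + (6 * ε : ℂ) • (star (jet 0 f) * jet 0 f * jet 1 f)

theorem Equation.field_apply (e : Equation) (ε : ℝ) (f : 𝓢(ℝ, ℂ)) (x : ℝ) :
    e.field ε f x = e.vectorField ε f x := by
  have h : ((‖f x‖ ^ 2 : ℝ) : ℂ) = (starRingEnd ℂ) (f x) * f x := by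
    rw [mul_comm, Complex.mul_conj, Complex.normSq_eq_norm_sq]
  cases e
  · simp only [field, vectorField, ← jet_eq_iteratedDeriv, h]
    simp [jet_zero_apply]
    ring
  · simp only [field, vectorField, ← jet_eq_iteratedDeriv, ← iteratedDeriv_one, h]
    simp [jet_zero_apply]
    ring

theorem Equation.continuous_field (e : Equation) (ε : ℝ) : Continuous (e.field ε) := by
  cases e
  · change Continuous fun f => (-Complex.I) •
      (-jet 2 f + (2 * ε : ℂ) • (star (jet 0 f) * jet 0 f * jet 0 f))
    fun_prop
  · change Continuous fun f => -jet 3 f + (6 * ε : ℂ) • (star (jet 0 f) * jet 0 f * jet 1 f)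
    fun_prop

theorem Equation.exists_decay_field (e : Equation) (ε : ℝ) : ∃ K : 𝓢(ℝ, ℂ) → ℝ, Continuous K ∧
    (∀ f, 0 ≤ K f) ∧ ∀ f x, ‖e.field ε f x‖ ≤ K f / (1 + x ^ 2) := by
  have key : ∀ (c d : ℂ) (k l : ℕ), ∃ K : 𝓢(ℝ, ℂ) → ℝ, Continuous K ∧
      (∀ f, 0 ≤ K f) ∧ ∀ f x,
        ‖c * jet k f x + d * ((starRingEnd ℂ) (f x) * f x * jet l f x)‖ ≤ K f / (1 + x ^ 2) := by
    intro c d k l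
    obtain ⟨K₁, hK₁, hp₁, hb₁⟩ := exists_decay_jet k
    obtain ⟨K₂, hK₂, hp₂, hb₂⟩ := exists_decay_jet l
    refine ⟨fun f => ‖c‖ * K₁ f + ‖d‖ * (‖jet 0 f‖ * ‖jet 0 f‖ * K₂ f), by fun_prop,
      fun f => by have := hp₁ f; have := hp₂ f; positivity, fun f x => ?_⟩
    refine (norm_add_le _ _).trans ?_
    simp only [norm_mul, RCLike.norm_conj]
    have h0 : ‖f x‖ ≤ ‖jet 0 f‖ := (jet 0 f).norm_coe_le_norm x
    rw [add_div, mul_div_assoc, mul_div_assoc, mul_div_assoc]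
    gcongr
    · exact hb₁ f x
    · exact hb₂ f x
  cases e
  · obtain ⟨K, h1, h2, h3⟩ := key Complex.I (-Complex.I * (2 * ε)) 2 0
    refine ⟨K, h1, h2, fun f x => le_trans (le_of_eq ?_) (h3 f x)⟩
    simp [field, jet_zero_apply]
    ring_nf
  · obtain ⟨K, h1, h2, h3⟩ := key (-1) (6 * ε) 3 1
    refine ⟨K, h1, h2, fun f x => le_trans (le_of_eq ?_) (h3 f x)⟩
    simp [field, jet_zero_apply]

end Jets

/-! ### Differentiation in time -/

section TimeDerivative

/-- A family of bounded continuous functions that is pointwise differentiable in time, with a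
derivative that is continuous in the uniform norm, is differentiable in the uniform norm. -/
theorem hasDerivAt_of_pointwise {Q V : ℝ → ℝ →ᵇ ℂ} (hV : Continuous V)
    (h : ∀ t x, HasDerivAt (fun τ => Q τ x) (V t x) t) (t : ℝ) : HasDerivAt Q (V t) t := by
  rw [hasDerivAt_iff_isLittleO, Asymptotics.isLittleO_iff]
  intro c hc
  obtain ⟨d, hd, hball⟩ := Metric.continuousAt_iff.1 hV.continuousAt c hc
  filter_upwards [Metric.ball_mem_nhds t hd] with s hs
  rw [BoundedContinuousFunction.norm_le (by positivity)]
  intro x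
  have hder : ∀ τ ∈ Metric.ball t d,
      HasDerivWithinAt (fun τ : ℝ => Q τ x - (τ : ℂ) * V t x) (V τ x - V t x)
        (Metric.ball t d) τ := fun τ _ => by
    have h1 : HasDerivAt (fun τ : ℝ => (τ : ℂ) * V t x) (1 * V t x) τ :=
      ((hasDerivAt_id τ).ofReal_comp).mul_const _
    rw [one_mul] at h1
    exact ((h τ x).sub h1).hasDerivWithinAt
  have hbd : ∀ τ ∈ Metric.ball t d, ‖V τ x - V t x‖ ≤ c := fun τ hτ => by
    rw [← dist_eq_norm]
    exact (BoundedContinuousFunction.dist_coe_le_dist x).trans (hball hτ).le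
  -- Mean value inequality at fixed `x`; the radius `d` comes from uniform-norm continuity of `V`,
  -- so the estimate is uniform in `x`.
  have := (convex_ball t d).norm_image_sub_le_of_norm_hasDerivWithin_le hder hbd
    (Metric.mem_ball_self hd) hs
  refine le_trans (le_of_eq ?_) this
  congr 1
  simp
  ring

theorem hasDerivAt_eval {u : ℝ → ℝ →ᵇ ℂ} {w : ℝ →ᵇ ℂ} {t : ℝ} (h : HasDerivAt u w t) (x : ℝ) :
    HasDerivAt (fun s => u s x) (w x) t :=
  ((BoundedContinuousFunction.evalCLM ℝ x).hasFDerivAt.comp_hasDerivAt t h :)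

theorem IsSchwartzSolution.continuous_field {e : Equation} {ε : ℝ} {q : ℝ → 𝓢(ℝ, ℂ)}
    (hq : IsSchwartzSolution e ε q) : Continuous fun t => e.field ε (q t) :=
  (e.continuous_field ε).comp hq.continuous

theorem IsSchwartzSolution.hasDerivAt_jet {e : Equation} {ε : ℝ} {q : ℝ → 𝓢(ℝ, ℂ)}
    (hq : IsSchwartzSolution e ε q) (t : ℝ) :
    HasDerivAt (fun s => jet 0 (q s)) (e.field ε (q t)) t :=
  hasDerivAt_of_pointwise (V := fun t => e.field ε (q t)) hq.continuous_field
    (fun t x => by rw [e.field_apply]; exact hq.hasDerivAt t x) t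

/-- Integrals of densities `q̄ u` obeying a local conservation law are conserved. -/
theorem IsSchwartzSolution.integral_conj_mul_eq {e : Equation} {ε : ℝ} {q : ℝ → 𝓢(ℝ, ℂ)}
    (hq : IsSchwartzSolution e ε q) {u w : ℝ → ℝ →ᵇ ℂ} (hw : Continuous w)
    (hu : ∀ t, HasDerivAt u (w t) t) {J : ℝ → ℝ → ℂ} (hJi : ∀ t, Integrable (J t))
    (hJ : ∀ t x, HasDerivAt (J t) ((starRingEnd ℂ) (e.field ε (q t) x) * u t x +
      (starRingEnd ℂ) (q t x) * w t x) x) (t : ℝ) :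
    ∫ x, (starRingEnd ℂ) (q t x) * u t x = ∫ x, (starRingEnd ℂ) (q 0 x) * u 0 x := by
  obtain ⟨K₁, hK₁, hp₁, hb₁⟩ := e.exists_decay_field ε
  obtain ⟨K₂, hK₂, hp₂, hb₂⟩ := exists_decay_jet 0
  have huc : Continuous u := continuous_iff_continuousAt.2 fun t => (hu t).continuousAt
  have hqc := hq.continuous
  let K : ℝ → ℝ := fun t => K₁ (q t) * ‖u t‖ + K₂ (q t) * ‖w t‖
  have hK : Continuous K := by fun_prop
  let G : ℝ → ℝ → ℂ := fun t x => (starRingEnd ℂ) (e.field ε (q t) x) * u t x +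
      (starRingEnd ℂ) (q t x) * w t x
  have hGK : ∀ t x, ‖G t x‖ ≤ K t * (1 + x ^ 2)⁻¹ := fun t x => by
    refine (norm_add_le _ _).trans ?_
    rw [norm_mul, norm_mul, RCLike.norm_conj, RCLike.norm_conj, add_mul]
    have h1 := mul_le_mul (hb₁ (q t) x) ((u t).norm_coe_le_norm x) (norm_nonneg _)
      (div_nonneg (hp₁ _) (by positivity))
    have h2 := mul_le_mul (hb₂ (q t) x) ((w t).norm_coe_le_norm x) (norm_nonneg _)
      (div_nonneg (hp₂ _) (by positivity))
    rw [jet_zero_apply] at h2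
    refine (add_le_add h1 h2).trans (le_of_eq ?_)
    ring
  have hGc : ∀ t, Continuous (G t) := fun t => by
    have h1 := (e.field ε (q t)).continuous
    have h2 := (q t).continuous
    have h3 := Complex.continuous_conj
    exact ((h3.comp h1).mul (u t).continuous).add ((h3.comp h2).mul (w t).continuous)
  have hder : ∀ t, HasDerivAt (fun t => ∫ x, (starRingEnd ℂ) (q t x) * u t x) 0 t := by
    intro t
    -- Near `t` the continuous envelope `K` stays below `K t + 1`, which gives a time-independent
    -- integrable majorant.
    have hnhds : {s | K s < K t + 1} ∈ 𝓝 t :=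
      (isOpen_lt hK continuous_const).mem_nhds (by simp)
    have h := (hasDerivAt_integral_of_dominated_loc_of_deriv_le (μ := volume)
      (F := fun t x => (starRingEnd ℂ) (q t x) * u t x) (F' := G) (x₀ := t)
      (bound := fun x => (K t + 1) * (1 + x ^ 2)⁻¹) hnhds
      (Eventually.of_forall fun s => (integrable_conj_jet_mul 0 (q s) (u s)).aestronglyMeasurable)
      (integrable_conj_jet_mul 0 (q t) (u t)) (hGc t).aestronglyMeasurable
      (Eventually.of_forall fun x s hs => (hGK s x).trans
        (mul_le_mul_of_nonneg_right (le_of_lt hs) (by positivity)))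
      (integrable_inv_one_add_sq.const_mul _)
      (Eventually.of_forall fun x s _ => ?_))
    -- The differentiated density is the `x`-derivative of the integrable flux `J t`, which is
    -- itself integrable, so its integral vanishes.
    · rw [integral_eq_zero_of_hasDerivAt_of_integrable (hJ t) h.1 (hJi t)] at h
      exact h.2
    · have h1 := (hasDerivAt_eval (hq.hasDerivAt_jet s) x).star
      exact h1.mul (hasDerivAt_eval (hu s) x)
  exact is_const_of_deriv_eq_zero (fun t => (hder t).differentiableAt)
    (fun t => (hder t).deriv) t 0

end TimeDerivative

/-! ### Conservation of the `L²` norm and of `∫ q̄ r` -/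

section Conservation

theorem IsSchwartzSolution.l2Norm_eq {e : Equation} {ε : ℝ} {q : ℝ → 𝓢(ℝ, ℂ)}
    (hq : IsSchwartzSolution e ε q) (t : ℝ) : l2Norm (q t) = l2Norm (q 0) := by
  have key : ∀ f : 𝓢(ℝ, ℂ), ∃ J : ℝ → ℂ, Integrable J ∧ ∀ x, HasDerivAt J
      ((starRingEnd ℂ) (e.field ε f x) * jet 0 f x +
        (starRingEnd ℂ) (f x) * e.field ε f x) x := by
    intro f
    have d0 := DispersiveFlows.hasDerivAt_jet 0 f
    have d1 := DispersiveFlows.hasDerivAt_jet 1 f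
    have d2 := DispersiveFlows.hasDerivAt_jet 2 f
    have c0 := hasDerivAt_conj_jet 0 f
    have c1 := hasDerivAt_conj_jet 1 f
    have c2 := hasDerivAt_conj_jet 2 f
    cases e
    · refine ⟨fun x => (starRingEnd ℂ) (jet 0 f x) * (Complex.I • jet 1 f) x +
        (starRingEnd ℂ) (jet 1 f x) * (-Complex.I • jet 0 f) x,
        (integrable_conj_jet_mul _ _ _).add (integrable_conj_jet_mul _ _ _), fun x => ?_⟩
      refine (((c0 x).mul ((d1 x).const_mul Complex.I)).add
        ((c1 x).mul ((d0 x).const_mul (-Complex.I)))).congr_deriv ?_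
      simp [Equation.field, ← jet_zero_apply, Complex.conj_ofNat]
      ring
    · refine ⟨fun x => (starRingEnd ℂ) (jet 0 f x) *
          ((3 * ε : ℂ) • (star (jet 0 f) * jet 0 f * jet 0 f) - jet 2 f) x +
          (starRingEnd ℂ) (jet 1 f x) * jet 1 f x - (starRingEnd ℂ) (jet 2 f x) * jet 0 f x,
        ((integrable_conj_jet_mul _ _ _).add (integrable_conj_jet_mul _ _ _)).sub
          (integrable_conj_jet_mul _ _ _), fun x => ?_⟩
      refine ((((c0 x).mul (((((c0 x).mul (d0 x)).mul (d0 x)).const_mul (3 * ε : ℂ)).sub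
        (d2 x))).add ((c1 x).mul (d1 x))).sub ((c2 x).mul (d0 x))).congr_deriv ?_
      simp [Equation.field, ← jet_zero_apply, Complex.conj_ofNat]
      ring
  choose J hJi hJ using key
  have h := hq.integral_conj_mul_eq hq.continuous_field hq.hasDerivAt_jet
    (J := fun t => J (q t)) (fun t => hJi _) (fun t => hJ _) t
  have h1 : ∀ f : 𝓢(ℝ, ℂ), ∫ x, (starRingEnd ℂ) (f x) * jet 0 f x =
      ((l2Norm f ^ 2 : ℝ) : ℂ) := fun f => by
    rw [l2Norm_sq, ← integral_complex_ofReal]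
    refine integral_congr_ae (Eventually.of_forall fun x => ?_)
    simp [jet_zero_apply, mul_comm, Complex.mul_conj, Complex.normSq_eq_norm_sq]
  rw [h1, h1, Complex.ofReal_inj] at h
  exact (sq_eq_sq₀ (l2Norm_nonneg _) (l2Norm_nonneg _)).1 h

/-- Bounded solutions of the Riccati equation depend differentiably on time, and the derivative is
the bounded solution of the linearized equation. -/
theorem IsSchwartzSolution.hasDerivAt_riccati {e : Equation} {ε κ : ℝ} {q : ℝ → 𝓢(ℝ, ℂ)}
    (hq : IsSchwartzSolution e ε q) (hκ : 1 ≤ κ) (hε : ‖(ε : ℂ)‖ = 1)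
    (hs : ∀ t, l2Norm (q t) ≤ 1 / 2) {r : ℝ → ℝ →ᵇ ℂ} (hr : ∀ t, IsRiccati κ ε (q t) (r t))
    {W : ℝ →ᵇ ℂ} {t : ℝ} (hW : ∀ x, HasDerivAt W (-(2 * κ) * W x + (e.field ε (q t) x -
      ε * (starRingEnd ℂ) (e.field ε (q t) x) * r t x ^ 2 -
      ε * (starRingEnd ℂ) (q t x) * (2 * r t x * W x))) x) :
    HasDerivAt r W t := by
  have hr2 : ∀ s, ‖r s‖ ≤ 1 / 2 := fun s => (hr s).norm_le.trans (l2Norm_div_sqrt_le hκ (hs s))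
  have hm : ∀ s, ‖r s + r t‖ ≤ 1 := fun s =>
    (norm_add_le _ _).trans (by linarith [hr2 s, hr2 t])
  have hrr : ∀ s, ‖r s * r s‖ ≤ 1 := fun s =>
    (norm_mul_le _ _).trans (by nlinarith [hr2 s, norm_nonneg (r s)])
  have hstar : ∀ (u : ℝ →ᵇ ℂ) s, ‖u - (ε : ℂ) • (star u * (r s * r s))‖ ≤ 2 * ‖u‖ := by
    intro u s
    refine (norm_sub_le _ _).trans ?_
    rw [norm_smul, hε]
    have h1 := norm_mul_le (star u) (r s * r s)
    rw [norm_star] at h1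
    nlinarith [hrr s, norm_nonneg u]
  -- The difference of two Riccati solutions solves the linearized equation with `m = r s + r t`,
  -- because `a² - b² = (a + b)(a - b)`.
  have hlip : ∀ s, ‖r s - r t‖ ≤ 2 * ‖jet 0 (q s) - jet 0 (q t)‖ := by
    intro s
    refine (norm_le_of_linearized hκ hε (hs t) (hm s)
      (g := (jet 0 (q s) - jet 0 (q t)) -
        (ε : ℂ) • (star (jet 0 (q s) - jet 0 (q t)) * (r s * r s))) fun x => ?_).trans
      (hstar _ s)
    refine (((hr s).hasDerivAt x).sub ((hr t).hasDerivAt x)).congr_deriv ?_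
    simp [jet_zero_apply]
    ring
  have hQ := hq.hasDerivAt_jet t
  have hrlim : Tendsto (fun s => ‖r s - r t‖) (𝓝 t) (𝓝 0) := by
    refine squeeze_zero (fun s => norm_nonneg _) hlip ?_
    have h1 : Tendsto (fun s => jet 0 (q s) - jet 0 (q t)) (𝓝 t) (𝓝 0) := by
      simpa using hQ.continuousAt.tendsto.sub_const (jet 0 (q t))
    simpa using h1.norm.const_mul 2
  set V := e.field ε (q t) with hV
  set Q := jet 0 (q t) with hQdef
  have hmain : ∀ s, ‖r s - r t - (s - t) • W‖ ≤ 2 * ‖jet 0 (q s) - Q - (s - t) • V‖ +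
      ‖r s - r t‖ * (‖V‖ + ‖Q‖ * ‖W‖) * |s - t| := by
    intro s
    -- Forcing of the linearized equation for the remainder `r s - r t - (s - t)W`. The first group
    -- carries the Taylor remainder of `q`; the second collects the mismatch between `m = r s + r t`
    -- and `2 r t`, and is `O(|s - t| ‖r s - r t‖)`, hence `o(|s - t|)`.
    set g : ℝ →ᵇ ℂ := ((jet 0 (q s) - Q - (s - t) • V) -
      (ε : ℂ) • (star (jet 0 (q s) - Q - (s - t) • V) * (r s * r s))) -
      (s - t) • ((ε : ℂ) • ((r s - r t) * (star V * (r s + r t) + star Q * W))) with hg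
    have hgn : ‖g‖ ≤ 2 * ‖jet 0 (q s) - Q - (s - t) • V‖ +
        ‖r s - r t‖ * (‖V‖ + ‖Q‖ * ‖W‖) * |s - t| := by
      refine (norm_sub_le _ _).trans (add_le_add (hstar _ s) ?_)
      rw [norm_smul, norm_smul, hε, one_mul, Real.norm_eq_abs, mul_comm]
      gcongr
      refine (norm_mul_le _ _).trans ?_
      gcongr
      refine (norm_add_le _ _).trans (add_le_add ?_ ?_)
      · refine (norm_mul_le _ _).trans ?_
        rw [norm_star]
        exact mul_le_of_le_one_right (norm_nonneg _) (hm s)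
      · refine (norm_mul_le _ _).trans ?_
        rw [norm_star]
    refine (norm_le_of_linearized hκ hε (hs t) (hm s) (g := g) fun x => ?_).trans hgn
    refine ((((hr s).hasDerivAt x).sub ((hr t).hasDerivAt x)).sub
      ((hW x).const_smul (s - t))).congr_deriv ?_
    simp [hg, hQdef, jet_zero_apply]
    ring
  rw [hasDerivAt_iff_isLittleO, Asymptotics.isLittleO_iff]
  intro c hc
  have hQ' := (Asymptotics.isLittleO_iff.1 (hasDerivAt_iff_isLittleO.1 hQ)) (c := c / 4)
    (by positivity)
  have h2 : ∀ᶠ s in 𝓝 t, ‖r s - r t‖ * (‖V‖ + ‖Q‖ * ‖W‖) < c / 2 := by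
    have h3 := hrlim.mul_const (‖V‖ + ‖Q‖ * ‖W‖)
    rw [zero_mul] at h3
    exact h3.eventually_lt_const (by positivity)
  filter_upwards [hQ', h2] with s h3 h4
  refine (hmain s).trans ?_
  rw [Real.norm_eq_abs] at h3 ⊢
  nlinarith [mul_le_mul_of_nonneg_right h4.le (abs_nonneg (s - t))]

/-- The time derivative of the Riccati solution, from the temporal part of the Lax pair. -/
noncomputable def Equation.riccatiField (e : Equation) (ε κ : ℝ) (f : 𝓢(ℝ, ℂ)) (r : ℝ →ᵇ ℂ) :
    ℝ →ᵇ ℂ :=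
  match e with
  | .nls => Complex.I • (jet 1 f - (2 * κ : ℂ) • jet 0 f + (4 * κ ^ 2 : ℂ) • r -
      (2 * ε : ℂ) • (jet 0 f * star (jet 0 f) * r) +
      (ε : ℂ) • (((2 * κ : ℂ) • star (jet 0 f) + star (jet 1 f)) * (r * r)))
  | .mkdv => (-(4 * κ ^ 2) : ℂ) • jet 0 f + (2 * κ : ℂ) • jet 1 f - jet 2 f +
      (2 * ε : ℂ) • (jet 0 f * jet 0 f * star (jet 0 f)) +
      (2 : ℂ) • (((4 * κ ^ 3 : ℂ) • r - (2 * κ * ε : ℂ) • (jet 0 f * star (jet 0 f) * r)) +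
        (ε : ℂ) • ((star (jet 0 f) * jet 1 f - jet 0 f * star (jet 1 f)) * r)) -
      (ε : ℂ) • (((-(4 * κ ^ 2) : ℂ) • star (jet 0 f) - (2 * κ : ℂ) • star (jet 1 f) -
        star (jet 2 f) + (2 * ε : ℂ) • (jet 0 f * star (jet 0 f) * star (jet 0 f))) * (r * r))

theorem Equation.continuous_riccatiField (e : Equation) (ε κ : ℝ) {q : ℝ → 𝓢(ℝ, ℂ)}
    {r : ℝ → ℝ →ᵇ ℂ} (hq : Continuous q) (hr : Continuous r) :
    Continuous fun t => e.riccatiField ε κ (q t) (r t) := by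
  cases e
  · change Continuous fun t => Complex.I • (jet 1 (q t) - (2 * κ : ℂ) • jet 0 (q t) +
      (4 * κ ^ 2 : ℂ) • r t - (2 * ε : ℂ) • (jet 0 (q t) * star (jet 0 (q t)) * r t) +
      (ε : ℂ) • (((2 * κ : ℂ) • star (jet 0 (q t)) + star (jet 1 (q t))) * (r t * r t)))
    fun_prop
  · simp only [riccatiField]
    fun_prop

/-- The zero-curvature identity of the Lax pair, checked by expansion. The equation is the formal
time derivative of the Riccati equation, and boundedness is built into the type. -/
theorem IsRiccati.hasDerivAt_riccatiField {e : Equation} {ε κ : ℝ} {f : 𝓢(ℝ, ℂ)} {r : ℝ →ᵇ ℂ}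
    (hr : IsRiccati κ ε f r) (x : ℝ) :
    HasDerivAt (e.riccatiField ε κ f r) (-(2 * κ) * e.riccatiField ε κ f r x +
      (e.field ε f x - ε * (starRingEnd ℂ) (e.field ε f x) * r x ^ 2 -
        ε * (starRingEnd ℂ) (f x) * (2 * r x * e.riccatiField ε κ f r x))) x := by
  have d0 := hasDerivAt_jet 0 f x
  have d1 := hasDerivAt_jet 1 f x
  have d2 := hasDerivAt_jet 2 f x
  have c0 := hasDerivAt_conj_jet 0 f x
  have c1 := hasDerivAt_conj_jet 1 f x
  have c2 := hasDerivAt_conj_jet 2 f x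
  have dr := hr.hasDerivAt x
  cases e
  · refine ((((((d1.sub (d0.const_mul (2 * κ : ℂ))).add (dr.const_mul (4 * κ ^ 2 : ℂ))).sub
      (((d0.mul c0).mul dr).const_mul (2 * ε : ℂ))).add
      ((((c0.const_mul (2 * κ : ℂ)).add c1).mul (dr.mul dr)).const_mul (ε : ℂ))).const_mul
        Complex.I)).congr_deriv ?_
    simp [Equation.field, Equation.riccatiField, ← jet_zero_apply, Complex.conj_ofNat]
    ring
  · refine ((((((d0.const_mul (-(4 * κ ^ 2) : ℂ)).add (d1.const_mul (2 * κ : ℂ))).sub d2).add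
      (((d0.mul d0).mul c0).const_mul (2 * ε : ℂ))).add
      ((((dr.const_mul (4 * κ ^ 3 : ℂ)).sub
        (((d0.mul c0).mul dr).const_mul (2 * κ * ε : ℂ))).add
        ((((c0.mul d1).sub (d0.mul c1)).mul dr).const_mul (ε : ℂ))).const_mul (2 : ℂ))).sub
      ((((((c0.const_mul (-(4 * κ ^ 2) : ℂ)).sub (c1.const_mul (2 * κ : ℂ))).sub c2).add
        (((d0.mul c0).mul c0).const_mul (2 * ε : ℂ))).mul (dr.mul dr)).const_mul
          (ε : ℂ))).congr_deriv ?_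
    simp [Equation.field, Equation.riccatiField, ← jet_zero_apply, Complex.conj_ofNat]
    ring

/-- The flux of the microscopic conservation law for the density `q̄ r`. -/
theorem IsRiccati.exists_flux (e : Equation) {ε κ : ℝ} {f : 𝓢(ℝ, ℂ)} {r : ℝ →ᵇ ℂ}
    (hr : IsRiccati κ ε f r) : ∃ J : ℝ → ℂ, Integrable J ∧ ∀ x, HasDerivAt J
      ((starRingEnd ℂ) (e.field ε f x) * r x +
        (starRingEnd ℂ) (f x) * e.riccatiField ε κ f r x) x := by
  have d0 := hasDerivAt_jet 0 f
  have d1 := hasDerivAt_jet 1 f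
  have c0 := hasDerivAt_conj_jet 0 f
  have c1 := hasDerivAt_conj_jet 1 f
  have c2 := hasDerivAt_conj_jet 2 f
  have dr := hr.hasDerivAt
  cases e
  · refine ⟨fun x => (starRingEnd ℂ) (jet 0 f x) *
        (Complex.I • (jet 0 f - (2 * κ : ℂ) • r)) x +
        (starRingEnd ℂ) (jet 1 f x) * (-Complex.I • r) x,
      (integrable_conj_jet_mul _ _ _).add (integrable_conj_jet_mul _ _ _), fun x => ?_⟩
    refine (((c0 x).mul (((d0 x).sub ((dr x).const_mul (2 * κ : ℂ))).const_mul Complex.I)).add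
      ((c1 x).mul ((dr x).const_mul (-Complex.I)))).congr_deriv ?_
    simp [Equation.field, Equation.riccatiField, ← jet_zero_apply, Complex.conj_ofNat]
    ring
  · refine ⟨fun x => (starRingEnd ℂ) (jet 0 f x) *
        ((-(4 * κ ^ 2) : ℂ) • r + (2 * ε : ℂ) • (jet 0 f * star (jet 0 f) * r) +
          (2 * κ : ℂ) • jet 0 f - jet 1 f) x +
        (starRingEnd ℂ) (jet 1 f x) * (jet 0 f - (2 * κ : ℂ) • r) x -
        (starRingEnd ℂ) (jet 2 f x) * r x,
      ((integrable_conj_jet_mul _ _ _).add (integrable_conj_jet_mul _ _ _)).sub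
        (integrable_conj_jet_mul _ _ _), fun x => ?_⟩
    refine ((((c0 x).mul (((((dr x).const_mul (-(4 * κ ^ 2) : ℂ)).add
      ((((d0 x).mul (c0 x)).mul (dr x)).const_mul (2 * ε : ℂ))).add
      ((d0 x).const_mul (2 * κ : ℂ))).sub (d1 x))).add
      ((c1 x).mul ((d0 x).sub ((dr x).const_mul (2 * κ : ℂ))))).sub
      ((c2 x).mul (dr x))).congr_deriv ?_
    simp [Equation.field, Equation.riccatiField, ← jet_zero_apply, Complex.conj_ofNat]
    ring

theorem IsSchwartzSolution.integral_conj_mul_riccati_eq {e : Equation} {ε κ : ℝ}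
    {q : ℝ → 𝓢(ℝ, ℂ)} (hq : IsSchwartzSolution e ε q) (hκ : 1 ≤ κ) (hε : ‖(ε : ℂ)‖ = 1)
    (hs : ∀ t, l2Norm (q t) ≤ 1 / 2) {r : ℝ → ℝ →ᵇ ℂ} (hr : ∀ t, IsRiccati κ ε (q t) (r t))
    (t : ℝ) :
    ∫ x, (starRingEnd ℂ) (q t x) * r t x = ∫ x, (starRingEnd ℂ) (q 0 x) * r 0 x := by
  have hd : ∀ t, HasDerivAt r (e.riccatiField ε κ (q t) (r t)) t := fun t =>
    hq.hasDerivAt_riccati hκ hε hs hr (hr t).hasDerivAt_riccatiField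
  have hrc : Continuous r := continuous_iff_continuousAt.2 fun t => (hd t).continuousAt
  choose J hJi hJ using fun t => (hr t).exists_flux e
  exact hq.integral_conj_mul_eq (e.continuous_riccatiField ε κ hq.continuous hrc) hd hJi hJ t

end Conservation

/-! ### The energy estimate for `σ = 0` -/

section LowRegularity

/-- The squared `H^{σ-1}_κ` norm of the derivative. -/
noncomputable def derivEnergy (σ κ : ℝ) (f : 𝓢(ℝ, ℂ)) : ℝ :=
  ∫ ξ, ξ ^ 2 * (4 * κ ^ 2 + ξ ^ 2) ^ (σ - 1) * ‖fourierHat f ξ‖ ^ 2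

theorem sobolevNorm_deriv_sq (σ κ : ℝ) (f : 𝓢(ℝ, ℂ)) :
    sobolevNorm (σ - 1) κ (deriv f) ^ 2 = derivEnergy σ κ f := by
  rw [sobolevNorm, Real.sq_sqrt (integral_nonneg fun ξ => by positivity), derivEnergy]
  refine integral_congr_ae (Eventually.of_forall fun ξ => ?_)
  simp only [norm_fourierHat_deriv_sq]
  ring

theorem derivEnergy_nonneg (σ κ : ℝ) (f : 𝓢(ℝ, ℂ)) : 0 ≤ derivEnergy σ κ f :=
  integral_nonneg fun ξ => by positivity

theorem sq_mul_rpow_le {σ κ : ℝ} (hσ : σ ≤ 1) (hκ : 1 ≤ κ) (ξ : ℝ) :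
    ξ ^ 2 * (4 * κ ^ 2 + ξ ^ 2) ^ (σ - 1) ≤ ξ ^ 2 := by
  refine mul_le_of_le_one_right (by positivity) (Real.rpow_le_one_of_one_le_of_nonpos ?_ ?_)
  · nlinarith [sq_nonneg ξ]
  · linarith

theorem integrable_derivEnergy {σ κ : ℝ} (hσ : σ ≤ 1) (hκ : 1 ≤ κ) (f : 𝓢(ℝ, ℂ)) :
    Integrable fun ξ => ξ ^ 2 * (4 * κ ^ 2 + ξ ^ 2) ^ (σ - 1) * ‖fourierHat f ξ‖ ^ 2 := by
  refine integrable_mul_norm_fourierHat_sq (C := 1) (by fun_prop) (fun ξ => ?_) f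
  rw [abs_of_nonneg (by positivity)]
  linarith [sq_mul_rpow_le hσ hκ ξ]

theorem integral_norm_mul_norm_le (f g : 𝓢(ℝ, ℂ)) :
    ∫ x, ‖f x‖ * ‖g x‖ ≤ l2Norm f * l2Norm g := by
  have h : ∀ f : 𝓢(ℝ, ℂ), MemLp (fun x => ‖f x‖) (ENNReal.ofReal 2) := fun f => by
    simpa using (f.memLp 2 volume).norm
  refine (integral_mul_le_Lp_mul_Lq_of_nonneg Real.HolderConjugate.two_two
    (Eventually.of_forall fun x => norm_nonneg (f x))
    (Eventually.of_forall fun x => norm_nonneg (g x)) (h f) (h g)).trans (le_of_eq ?_)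
  simp only [Real.rpow_two]
  rw [← l2Norm_sq, ← l2Norm_sq, ← Real.sqrt_eq_rpow, ← Real.sqrt_eq_rpow,
    Real.sqrt_sq (l2Norm_nonneg f), Real.sqrt_sq (l2Norm_nonneg g)]

theorem integrable_norm_mul_norm (f g : 𝓢(ℝ, ℂ)) : Integrable fun x => ‖f x‖ * ‖g x‖ :=
  (f.memLp 2 volume).norm.integrable_mul (g.memLp 2 volume).norm

/-- The conserved quantities agree with `H^{-1}_κ` energies up to a quartic error. -/
theorem IsRiccati.abs_derivEnergy_sub_le {κ ε : ℝ} (hκ : 1 ≤ κ) (hε : ‖(ε : ℂ)‖ = 1)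
    {f : 𝓢(ℝ, ℂ)} {r : ℝ →ᵇ ℂ} (hr : IsRiccati κ ε f r) :
    |derivEnergy 0 κ f - (l2Norm f ^ 2 - 2 * κ * (∫ x, (starRingEnd ℂ) (f x) * r x).re)| ≤
      l2Norm f ^ 4 / κ := by
  have hκ0 : 0 < κ := by linarith
  obtain ⟨w, hw, hwn, hwq⟩ := exists_resolvent hκ0 f
  have hE : derivEnergy 0 κ f =
      l2Norm f ^ 2 - 2 * κ * (∫ x, (starRingEnd ℂ) (w x) * f x).re := by
    rw [hwq, ← integral_norm_fourierHat_sq, ← integral_const_mul, ← integral_sub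
      (integrable_norm_fourierHat_sq f), derivEnergy]
    · refine integral_congr_ae (Eventually.of_forall fun ξ => ?_)
      have : (4 * κ ^ 2 + ξ ^ 2) ≠ 0 := by positivity
      simp only [zero_sub, Real.rpow_neg_one]
      field_simp
      ring
    · refine (integrable_mul_norm_fourierHat_sq (W := fun ξ => 2 * κ / (4 * κ ^ 2 + ξ ^ 2))
        (C := 1) (by fun_prop) (fun ξ => ?_) f).const_mul _
      rw [abs_of_nonneg (by positivity), div_le_iff₀ (by positivity)]
      nlinarith [sq_nonneg ξ, mul_nonneg (sq_nonneg ξ) (sq_nonneg ξ),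
        mul_nonneg (sq_nonneg ξ) (sq_nonneg κ)]
  set a := fun x => (starRingEnd ℂ) (f x) * r x with ha
  set b := fun x => (starRingEnd ℂ) (w x) * f x with hb
  set c := fun x => (starRingEnd ℂ) (w x) * (ε * (starRingEnd ℂ) (f x) * r x ^ 2) with hc
  have hai : Integrable a := integrable_conj_jet_mul 0 f r
  have hbi : Integrable b := integrable_conj_jet_mul 0 w (jet 0 f)
  have hci : Integrable c :=
    (integrable_conj_jet_mul 0 w ((ε : ℂ) • (star (jet 0 f) * (r * r)))).congr
      (Eventually.of_forall fun x => by simp [hc, jet_zero_apply]; left; ring)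
  -- Pairing the Riccati equation with the adjoint resolvent `w = (2κ - ∂)⁻¹f`: in `(w̄ r)'` the
  -- terms `±2κ w̄ r` cancel, leaving `∫ f̄ r` as its quadratic part minus a quartic error.
  have hibp : ∫ x, (b x - c x - a x) = 0 := by
    refine integral_eq_zero_of_hasDerivAt_of_integrable (f := fun x => (starRingEnd ℂ) (w x) * r x)
      (fun x => ?_) ((hbi.sub hci).sub hai) (integrable_conj_jet_mul 0 w r)
    refine ((hw x).star.mul (hr.hasDerivAt x)).congr_deriv ?_
    simp [ha, hb, hc]
    ring
  rw [integral_sub (f := fun x => b x - c x) (hbi.sub hci) hai,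
    integral_sub hbi hci, sub_eq_zero] at hibp
  -- One factor `1/κ` comes from `‖r‖_∞²`, another `1/(2κ)` from `‖w‖_{L²}`.
  have hcb : ‖∫ x, c x‖ ≤ l2Norm f ^ 4 / (2 * κ ^ 2) := by
    have h1 : ∀ x, ‖c x‖ ≤ (l2Norm f / Real.sqrt κ) ^ 2 * (‖w x‖ * ‖f x‖) := fun x => by
      simp only [hc, norm_mul, RCLike.norm_conj, hε, norm_pow, one_mul]
      have h2 : ‖r x‖ ^ 2 ≤ (l2Norm f / Real.sqrt κ) ^ 2 :=
        pow_le_pow_left₀ (norm_nonneg _) ((r.norm_coe_le_norm x).trans hr.norm_le) 2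
      calc _ = ‖r x‖ ^ 2 * (‖w x‖ * ‖f x‖) := by ring
        _ ≤ _ := by gcongr
    calc _ ≤ ∫ x, ‖c x‖ := norm_integral_le_integral_norm _
      _ ≤ ∫ x, (l2Norm f / Real.sqrt κ) ^ 2 * (‖w x‖ * ‖f x‖) :=
          integral_mono hci.norm ((integrable_norm_mul_norm w f).const_mul _) h1
      _ ≤ (l2Norm f / Real.sqrt κ) ^ 2 * (l2Norm f / (2 * κ) * l2Norm f) := by
          rw [integral_const_mul]
          gcongr
          exact (integral_norm_mul_norm_le w f).trans
            (mul_le_mul_of_nonneg_right hwn (l2Norm_nonneg f))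
      _ = _ := by
          rw [div_pow, Real.sq_sqrt hκ0.le]
          field_simp
  rw [hE, ← hibp, Complex.sub_re]
  have h3 := (Complex.abs_re_le_norm (∫ x, c x)).trans hcb
  have h4 : l2Norm f ^ 2 - 2 * κ * (∫ x, b x).re -
      (l2Norm f ^ 2 - 2 * κ * ((∫ x, b x).re - (∫ x, c x).re)) = -(2 * κ * (∫ x, c x).re) := by
    ring
  rw [h4, abs_neg, abs_mul, abs_of_pos (by positivity)]
  calc _ ≤ 2 * κ * (l2Norm f ^ 4 / (2 * κ ^ 2)) := by gcongr
    _ = _ := by field_simp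

/-- The energy is compared with the conserved quantity at both times, so the quartic error enters
twice. `L²` conservation keeps the solution small, so that `r` exists at every time. -/
theorem IsSchwartzSolution.derivEnergy_zero_le {e : Equation} {ε κ : ℝ} {q : ℝ → 𝓢(ℝ, ℂ)}
    (hq : IsSchwartzSolution e ε q) (hκ : 1 ≤ κ) (hε : ‖(ε : ℂ)‖ = 1)
    (hs : l2Norm (q 0) ≤ 1 / 2) (t : ℝ) :
    derivEnergy 0 κ (q t) ≤ derivEnergy 0 κ (q 0) + 2 * l2Norm (q 0) ^ 4 / κ := by
  have hs' : ∀ t, l2Norm (q t) ≤ 1 / 2 := fun t => (hq.l2Norm_eq t).trans_le hs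
  choose r hr using fun t => exists_isRiccati hκ hε (q t) (hs' t)
  have h1 := abs_le.1 ((hr t).abs_derivEnergy_sub_le hκ hε)
  have h2 := abs_le.1 ((hr 0).abs_derivEnergy_sub_le hκ hε)
  rw [hq.integral_conj_mul_riccati_eq hκ hε hs' hr t, hq.l2Norm_eq t] at h1
  have : 2 * l2Norm (q 0) ^ 4 / κ = l2Norm (q 0) ^ 4 / κ + l2Norm (q 0) ^ 4 / κ := by ring
  linarith [h1.2, h2.1]

end LowRegularity

/-! ### Averaging over the spectral parameter -/

section Averaging

/-- Only the dyadic block `m < k ≤ 2m`, with `m² = 4κ² + ξ²`, is kept. There the denominator is at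
most `17m²` and `k^{2σ-1} ≥ m^{2σ-1}/2`, whence `1/34`. -/
theorem lintegral_rpow_div_ge {σ κ : ℝ} (hσ₀ : 0 ≤ σ) (hσ : σ < 1 / 2) (hκ : 1 ≤ κ) (ξ : ℝ) :
    ENNReal.ofReal ((1 / 34) * (4 * κ ^ 2 + ξ ^ 2) ^ (σ - 1)) ≤
      ∫⁻ k in Set.Ioi κ, ENNReal.ofReal (k ^ (2 * σ - 1) / (4 * k ^ 2 + ξ ^ 2)) := by
  set m := Real.sqrt (4 * κ ^ 2 + ξ ^ 2) with hm
  have hm2 : m ^ 2 = 4 * κ ^ 2 + ξ ^ 2 := Real.sq_sqrt (by positivity)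
  have hκm : κ ≤ m := Real.le_sqrt_of_sq_le (by nlinarith [sq_nonneg ξ, sq_nonneg κ])
  have hm0 : 0 < m := by linarith
  have hpow : (4 * κ ^ 2 + ξ ^ 2) ^ (σ - 1) = m ^ (2 * σ - 2) := by
    rw [← hm2, ← Real.rpow_natCast, ← Real.rpow_mul hm0.le]
    congr 1
    push_cast
    ring
  have hsub : Set.Ioc m (2 * m) ⊆ Set.Ioi κ := fun k hk => lt_of_le_of_lt hκm hk.1
  refine le_trans ?_ (lintegral_mono_set hsub)
  have hpt : ∀ k ∈ Set.Ioc m (2 * m), ENNReal.ofReal ((1 / 34) * m ^ (2 * σ - 3)) ≤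
      ENNReal.ofReal (k ^ (2 * σ - 1) / (4 * k ^ 2 + ξ ^ 2)) := by
    intro k hk
    have hk0 : 0 < k := hm0.trans hk.1
    refine ENNReal.ofReal_le_ofReal ?_
    rw [le_div_iff₀ (by positivity)]
    have h1 : 4 * k ^ 2 + ξ ^ 2 ≤ 17 * m ^ 2 := by
      nlinarith [hk.2, sq_nonneg κ, pow_le_pow_left₀ hk0.le hk.2 2]
    have h2 : (2 * m) ^ (2 * σ - 1) ≤ k ^ (2 * σ - 1) :=
      Real.rpow_le_rpow_of_nonpos hk0 hk.2 (by linarith)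
    have h3 : (1 / 2 : ℝ) ≤ 2 ^ (2 * σ - 1) := by
      have := Real.rpow_le_rpow_of_exponent_le (x := 2) (by norm_num)
        (show (-1 : ℝ) ≤ 2 * σ - 1 by linarith)
      rw [Real.rpow_neg_one] at this
      linarith
    rw [Real.mul_rpow (by norm_num) hm0.le] at h2
    have h4 : m ^ (2 * σ - 3) * m ^ 2 = m ^ (2 * σ - 1) := by
      rw [← Real.rpow_natCast, ← Real.rpow_add hm0]
      congr 1
      push_cast
      ring
    have h5 : 0 < m ^ (2 * σ - 3) := Real.rpow_pos_of_pos hm0 _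
    have h6 : 0 < m ^ (2 * σ - 1) := Real.rpow_pos_of_pos hm0 _
    calc _ ≤ 1 / 34 * m ^ (2 * σ - 3) * (17 * m ^ 2) := by gcongr
      _ = 1 / 2 * m ^ (2 * σ - 1) := by rw [← h4]; ring
      _ ≤ 2 ^ (2 * σ - 1) * m ^ (2 * σ - 1) := by gcongr
      _ ≤ _ := h2
  refine le_trans ?_ (setLIntegral_mono' measurableSet_Ioc hpt)
  rw [setLIntegral_const, Real.volume_Ioc, ← ENNReal.ofReal_mul (by positivity), hpow]
  refine ENNReal.ofReal_le_ofReal (le_of_eq ?_)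
  have : m ^ (2 * σ - 2) = m ^ (2 * σ - 3) * m := by
    rw [← Real.rpow_add_one hm0.ne']
    congr 1
    ring
  rw [this]
  ring

theorem lintegral_Ioi_rpow {a c : ℝ} (ha : a < -1) (hc : 0 < c) :
    ∫⁻ k in Set.Ioi c, ENNReal.ofReal (k ^ a) = ENNReal.ofReal (-c ^ (a + 1) / (a + 1)) := by
  rw [← integral_Ioi_rpow_of_lt ha hc, ofReal_integral_eq_lintegral_ofReal
    (integrableOn_Ioi_rpow_of_lt ha hc)]
  exact (ae_restrict_mem measurableSet_Ioi).mono fun k hk =>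
    Real.rpow_nonneg (hc.trans hk).le _

theorem lintegral_Ioc_rpow {a c : ℝ} (ha : -1 < a) (hc : 0 < c) :
    ∫⁻ k in Set.Ioc 0 c, ENNReal.ofReal (k ^ a) = ENNReal.ofReal (c ^ (a + 1) / (a + 1)) := by
  have h := integral_rpow (a := 0) (b := c) (r := a) (Or.inl ha)
  rw [intervalIntegral.integral_of_le hc.le, Real.zero_rpow (by linarith), sub_zero] at h
  have hi := (intervalIntegrable_iff_integrableOn_Ioc_of_le hc.le).1
    (intervalIntegral.intervalIntegrable_rpow' (a := 0) (b := c) ha)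
  rw [← h, ofReal_integral_eq_lintegral_ofReal hi]
  exact (ae_restrict_mem measurableSet_Ioc).mono fun k hk => Real.rpow_nonneg hk.1.le _

/-- Split at `m = √(4κ² + ξ²)`. Below `m` the denominator is at least `m²`; above `m` it is at least
`k²`. The two pieces give the constants `1/(2σ)` and `1`. -/
theorem lintegral_rpow_div_le {σ κ : ℝ} (hσ₀ : 0 < σ) (hσ : σ < 1 / 2) (hκ : 1 ≤ κ) (ξ : ℝ) :
    ∫⁻ k in Set.Ioi κ, ENNReal.ofReal (k ^ (2 * σ - 1) / (4 * k ^ 2 + ξ ^ 2)) ≤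
      ENNReal.ofReal ((1 / (2 * σ) + 1) * (4 * κ ^ 2 + ξ ^ 2) ^ (σ - 1)) := by
  set m := Real.sqrt (4 * κ ^ 2 + ξ ^ 2) with hm
  have hm2 : m ^ 2 = 4 * κ ^ 2 + ξ ^ 2 := Real.sq_sqrt (by positivity)
  have hκm : κ ≤ m := Real.le_sqrt_of_sq_le (by nlinarith [sq_nonneg ξ, sq_nonneg κ])
  have hm0 : 0 < m := by linarith
  have hpow : (4 * κ ^ 2 + ξ ^ 2) ^ (σ - 1) = m ^ (2 * σ - 2) := by
    rw [← hm2, ← Real.rpow_natCast, ← Real.rpow_mul hm0.le]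
    congr 1
    push_cast
    ring
  have h0 : 0 < m ^ (2 * σ - 2) := Real.rpow_pos_of_pos hm0 _
  rw [← Set.Ioc_union_Ioi_eq_Ioi hκm, hpow, add_mul, ENNReal.ofReal_add (by positivity)
    (by positivity)]
  refine (lintegral_union_le _ _ _).trans (add_le_add ?_ ?_)
  · have h1 : ∀ k ∈ Set.Ioc κ m, ENNReal.ofReal (k ^ (2 * σ - 1) / (4 * k ^ 2 + ξ ^ 2)) ≤
        ENNReal.ofReal (m ^ (-2 : ℝ)) * ENNReal.ofReal (k ^ (2 * σ - 1)) := by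
      intro k hk
      have hk0 : 0 < k := by linarith [hk.1]
      rw [← ENNReal.ofReal_mul (by positivity), Real.rpow_neg hm0.le, Real.rpow_two, hm2,
        ← div_eq_inv_mul]
      refine ENNReal.ofReal_le_ofReal ?_
      have : κ ^ 2 ≤ k ^ 2 := pow_le_pow_left₀ (by linarith) hk.1.le 2
      gcongr
    refine (setLIntegral_mono' measurableSet_Ioc h1).trans ?_
    -- Extending the range down to `0` is harmless because `2σ - 1 > -1`; this is where `σ > 0` is
    -- needed.
    refine (lintegral_mono_set (Set.Ioc_subset_Ioc_left (by linarith : (0 : ℝ) ≤ κ))).trans ?_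
    rw [lintegral_const_mul' _ _ ENNReal.ofReal_ne_top, lintegral_Ioc_rpow (by linarith) hm0,
      ← ENNReal.ofReal_mul (by positivity)]
    refine ENNReal.ofReal_le_ofReal (le_of_eq ?_)
    rw [mul_div_assoc', ← Real.rpow_add hm0, show -2 + (2 * σ - 1 + 1) = 2 * σ - 2 by ring]
    field_simp
    ring_nf
  · have h1 : ∀ k ∈ Set.Ioi m, ENNReal.ofReal (k ^ (2 * σ - 1) / (4 * k ^ 2 + ξ ^ 2)) ≤
        ENNReal.ofReal (k ^ (2 * σ - 3)) := by
      intro k hk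
      have hk0 : 0 < k := hm0.trans hk
      refine ENNReal.ofReal_le_ofReal ?_
      have h2 : k ^ (2 * σ - 1) = k ^ (2 * σ - 3) * k ^ 2 := by
        rw [← Real.rpow_natCast, ← Real.rpow_add hk0]
        congr 1
        push_cast
        ring
      have h3 : 0 < k ^ (2 * σ - 3) := Real.rpow_pos_of_pos hk0 _
      rw [div_le_iff₀ (by positivity), h2]
      gcongr
      nlinarith [sq_nonneg ξ, sq_nonneg k]
    refine (setLIntegral_mono' measurableSet_Ioi h1).trans ?_
    rw [lintegral_Ioi_rpow (by linarith) hm0]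
    refine ENNReal.ofReal_le_ofReal ?_
    rw [show 2 * σ - 3 + 1 = 2 * σ - 2 by ring, neg_div, ← div_neg, one_mul]
    exact div_le_self h0.le (by linarith)

/-- Averaging `H^{-1}_k` energies over `k > κ`. -/
theorem lintegral_derivEnergy_eq {σ κ : ℝ} (hκ : 1 ≤ κ) (f : 𝓢(ℝ, ℂ)) :
    ∫⁻ k in Set.Ioi κ, ENNReal.ofReal (k ^ (2 * σ - 1) * derivEnergy 0 k f) =
      ∫⁻ ξ, ENNReal.ofReal (ξ ^ 2 * ‖fourierHat f ξ‖ ^ 2) *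
        ∫⁻ k in Set.Ioi κ, ENNReal.ofReal (k ^ (2 * σ - 1) / (4 * k ^ 2 + ξ ^ 2)) := by
  have hf := (continuous_fourierHat f).measurable
  have h1 : ∀ k ∈ Set.Ioi κ, ENNReal.ofReal (k ^ (2 * σ - 1) * derivEnergy 0 k f) =
      ∫⁻ ξ, ENNReal.ofReal (ξ ^ 2 * ‖fourierHat f ξ‖ ^ 2) *
        ENNReal.ofReal (k ^ (2 * σ - 1) / (4 * k ^ 2 + ξ ^ 2)) := by
    intro k hk
    have hk1 : 1 ≤ k := hκ.trans (le_of_lt hk)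
    have hk0 : 0 ≤ k := by linarith
    rw [derivEnergy, ← integral_const_mul, ofReal_integral_eq_lintegral_ofReal
      ((integrable_derivEnergy (by norm_num) hk1 f).const_mul _)
      (Eventually.of_forall fun ξ => by positivity)]
    refine lintegral_congr fun ξ => ?_
    rw [← ENNReal.ofReal_mul (by positivity), zero_sub, Real.rpow_neg_one]
    congr 1
    ring
  rw [setLIntegral_congr_fun measurableSet_Ioi h1, lintegral_lintegral_swap]
  · refine lintegral_congr fun ξ => ?_
    rw [lintegral_const_mul' _ _ ENNReal.ofReal_ne_top]
  · exact Measurable.aemeasurable (by fun_prop)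

theorem IsSchwartzSolution.derivEnergy_le {e : Equation} {ε σ κ : ℝ} {q : ℝ → 𝓢(ℝ, ℂ)}
    (hq : IsSchwartzSolution e ε q) (hσ₀ : 0 < σ) (hσ : σ < 1 / 2) (hκ : 1 ≤ κ)
    (hε : ‖(ε : ℂ)‖ = 1) (hs : l2Norm (q 0) ≤ 1 / 2) (t : ℝ) :
    (1 / 34) * derivEnergy σ κ (q t) ≤ (1 / (2 * σ) + 1) * derivEnergy σ κ (q 0) +
      2 / (1 - 2 * σ) * (κ ^ (2 * σ - 1) * l2Norm (q 0) ^ 4) := by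
  have hκ0 : 0 < κ := by linarith
  have hE : ∀ (c : ℝ), 0 ≤ c → ∀ f : 𝓢(ℝ, ℂ), ENNReal.ofReal (c * derivEnergy σ κ f) =
      ∫⁻ ξ, ENNReal.ofReal (ξ ^ 2 * ‖fourierHat f ξ‖ ^ 2) *
        ENNReal.ofReal (c * (4 * κ ^ 2 + ξ ^ 2) ^ (σ - 1)) := by
    intro c hc f
    rw [derivEnergy, ← integral_const_mul, ofReal_integral_eq_lintegral_ofReal
      ((integrable_derivEnergy (by linarith) hκ f).const_mul _)
      (Eventually.of_forall fun ξ => by positivity)]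
    refine lintegral_congr fun ξ => ?_
    rw [← ENNReal.ofReal_mul (by positivity)]
    congr 1
    ring
  have hlow : ENNReal.ofReal ((1 / 34) * derivEnergy σ κ (q t)) ≤
      ∫⁻ k in Set.Ioi κ, ENNReal.ofReal (k ^ (2 * σ - 1) * derivEnergy 0 k (q t)) := by
    rw [hE _ (by norm_num), lintegral_derivEnergy_eq hκ]
    refine lintegral_mono fun ξ => ?_
    gcongr
    exact lintegral_rpow_div_ge hσ₀.le hσ hκ ξ
  have hupp : ∫⁻ k in Set.Ioi κ, ENNReal.ofReal (k ^ (2 * σ - 1) * derivEnergy 0 k (q 0)) ≤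
      ENNReal.ofReal ((1 / (2 * σ) + 1) * derivEnergy σ κ (q 0)) := by
    rw [hE _ (by positivity), lintegral_derivEnergy_eq hκ]
    refine lintegral_mono fun ξ => ?_
    gcongr
    exact lintegral_rpow_div_le hσ₀ hσ hκ ξ
  -- The estimate for `σ = 0` at each `k`, weighted by `k^{2σ-1}`; its error becomes `k^{2σ-2}`,
  -- with integral `κ^{2σ-1}/(1 - 2σ)` over `k > κ`.
  have hmid : ∀ k ∈ Set.Ioi κ, ENNReal.ofReal (k ^ (2 * σ - 1) * derivEnergy 0 k (q t)) ≤
      ENNReal.ofReal (2 * l2Norm (q 0) ^ 4) * ENNReal.ofReal (k ^ (2 * σ - 2)) +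
        ENNReal.ofReal (k ^ (2 * σ - 1) * derivEnergy 0 k (q 0)) := by
    intro k hk
    have hk0 : 0 < k := hκ0.trans hk
    have h1 := hq.derivEnergy_zero_le (hκ.trans (le_of_lt hk)) hε hs t
    have h2 : k ^ (2 * σ - 1) = k ^ (2 * σ - 2) * k := by
      rw [← Real.rpow_add_one hk0.ne']
      congr 1
      ring
    have h3 : 0 < k ^ (2 * σ - 1) := Real.rpow_pos_of_pos hk0 _
    have h4 := derivEnergy_nonneg 0 k (q 0)
    rw [← ENNReal.ofReal_mul (by positivity), ← ENNReal.ofReal_add (by positivity)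
      (by positivity)]
    refine ENNReal.ofReal_le_ofReal ((mul_le_mul_of_nonneg_left h1 h3.le).trans (le_of_eq ?_))
    rw [mul_add, add_comm]
    congr 1
    rw [h2]
    field_simp
  have h := (hlow.trans (setLIntegral_mono' measurableSet_Ioi hmid))
  rw [lintegral_add_left (by fun_prop), lintegral_const_mul' _ _ ENNReal.ofReal_ne_top,
    lintegral_Ioi_rpow (by linarith) hκ0, ← ENNReal.ofReal_mul (by positivity)] at h
  have h5 : -κ ^ (2 * σ - 2 + 1) / (2 * σ - 2 + 1) = κ ^ (2 * σ - 1) / (1 - 2 * σ) := by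
    rw [show 2 * σ - 2 + 1 = 2 * σ - 1 by ring, neg_div, ← div_neg, neg_sub]
  have h6 : 0 < 1 - 2 * σ := by linarith
  have h7 := derivEnergy_nonneg σ κ (q 0)
  have h8 := h.trans (add_le_add_right hupp _)
  rw [h5, ← ENNReal.ofReal_add (by positivity) (by positivity),
    ENNReal.ofReal_le_ofReal_iff (by positivity)] at h8
  refine h8.trans (le_of_eq ?_)
  rw [add_comm]
  congr 1
  ring

end Averaging

/-! ### The bound for all `σ`, and equicontinuity as decay of energies -/

section Equicontinuity

theorem exists_derivEnergy_le {σ : ℝ} (hσ₀ : 0 ≤ σ) (hσ : σ < 1 / 2) :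
    ∃ C : ℝ, 0 < C ∧ ∀ (e : Equation) (ε : ℝ), (ε = 1 ∨ ε = -1) → ∀ q : ℝ → 𝓢(ℝ, ℂ),
      IsSchwartzSolution e ε q → l2Norm (q 0) ≤ 1 / 2 → ∀ t κ : ℝ, 1 ≤ κ →
        derivEnergy σ κ (q t) ≤
          C * (derivEnergy σ κ (q 0) + κ ^ (2 * σ - 1) * l2Norm (q 0) ^ 4) := by
  rcases hσ₀.eq_or_lt with rfl | hσ₀
  · refine ⟨2, by norm_num, fun e ε hε q hq hs t κ hκ => ?_⟩
    have h := hq.derivEnergy_zero_le hκ (norm_ofReal_of_eq hε) hs t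
    have h0 := derivEnergy_nonneg 0 κ (q 0)
    rw [mul_zero, zero_sub, Real.rpow_neg_one]
    have : 2 * l2Norm (q 0) ^ 4 / κ = 2 * (κ⁻¹ * l2Norm (q 0) ^ 4) := by ring
    linarith
  · have h1 : 0 < 1 - 2 * σ := by linarith
    refine ⟨34 * ((1 / (2 * σ) + 1) + 2 / (1 - 2 * σ)), by positivity,
      fun e ε hε q hq hs t κ hκ => ?_⟩
    have h := hq.derivEnergy_le hσ₀ hσ hκ (norm_ofReal_of_eq hε) hs t
    have h0 := derivEnergy_nonneg σ κ (q 0)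
    have h2 : 0 ≤ κ ^ (2 * σ - 1) * l2Norm (q 0) ^ 4 := by positivity
    have h3 : 0 ≤ (1 / (2 * σ) + 1) * (κ ^ (2 * σ - 1) * l2Norm (q 0) ^ 4) := by positivity
    have h4 : 0 ≤ 2 / (1 - 2 * σ) * derivEnergy σ κ (q 0) := by positivity
    linarith

theorem rpow_le_mul_one_add_sq {σ : ℝ} (hσ : σ ≤ 1) (ξ : ℝ) :
    (4 * 1 ^ 2 + ξ ^ 2) ^ σ ≤ 4 * (1 + ξ ^ 2) := by
  have h := Real.rpow_le_rpow_of_exponent_le (x := 4 * 1 ^ 2 + ξ ^ 2)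
    (by nlinarith [sq_nonneg ξ]) hσ
  rw [Real.rpow_one] at h
  nlinarith [sq_nonneg ξ]

theorem two_sub_two_mul_cos_nonneg (θ : ℝ) : 0 ≤ 2 - 2 * Real.cos θ := by
  linarith [Real.cos_le_one θ]

theorem two_sub_two_mul_cos_le (θ : ℝ) : 2 - 2 * Real.cos θ ≤ 4 := by
  linarith [Real.neg_one_le_cos θ]

theorem sobolevNorm_shift_sq (σ : ℝ) (f : 𝓢(ℝ, ℂ)) (y : ℝ) :
    sobolevNorm σ 1 (fun x => f (x + y) - f x) ^ 2 =
      ∫ ξ, (4 * 1 ^ 2 + ξ ^ 2) ^ σ * (2 - 2 * Real.cos (ξ * y)) * ‖fourierHat f ξ‖ ^ 2 := by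
  rw [sobolevNorm, Real.sq_sqrt (integral_nonneg fun ξ => by positivity)]
  refine integral_congr_ae (Eventually.of_forall fun ξ => ?_)
  simp only [norm_fourierHat_comp_add_sub_sq]
  ring

theorem integrable_shift {σ : ℝ} (hσ : σ ≤ 1) (f : 𝓢(ℝ, ℂ)) (y : ℝ) :
    Integrable fun ξ =>
      (4 * 1 ^ 2 + ξ ^ 2) ^ σ * (2 - 2 * Real.cos (ξ * y)) * ‖fourierHat f ξ‖ ^ 2 := by
  refine integrable_mul_norm_fourierHat_sq (C := 16) (by fun_prop) (fun ξ => ?_) f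
  have h0 : 0 ≤ (4 * 1 ^ 2 + ξ ^ 2) ^ σ := by positivity
  rw [abs_of_nonneg (mul_nonneg h0 (two_sub_two_mul_cos_nonneg _))]
  calc _ ≤ 4 * (1 + ξ ^ 2) * 4 := mul_le_mul (rpow_le_mul_one_add_sq hσ ξ)
        (two_sub_two_mul_cos_le _) (two_sub_two_mul_cos_nonneg _) (by positivity)
    _ = _ := by ring

/-- Functions with uniformly small high-frequency energy are equicontinuous. -/
theorem equicontinuousInSobolev_of_derivEnergy {σ M : ℝ} (hσ₀ : 0 ≤ σ) (hσ : σ ≤ 1)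
    {Q : Set 𝓢(ℝ, ℂ)} (hM : ∀ f ∈ Q, l2Norm f ≤ M)
    (h : ∀ η : ℝ, 0 < η → ∃ κ : ℝ, 1 ≤ κ ∧ ∀ f ∈ Q, derivEnergy σ κ f ≤ η) :
    EquicontinuousInSobolev σ Q := by
  intro η hη
  obtain ⟨κ, hκ, hκQ⟩ := h (η ^ 2 / 80) (by positivity)
  set D := (4 * 1 ^ 2 + κ ^ 2) ^ σ * κ ^ 2 * M ^ 2 with hD
  have hD0 : 0 ≤ D := by positivity
  refine ⟨η / (2 * (D + 1)), by positivity, fun f hf y hy => ?_⟩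
  -- For `|ξ| ≥ κ`, `4κ² + ξ² ≤ 5ξ²` and `2 - 2cos ≤ 4` give the factor `20`; for `|ξ| ≤ κ`, `2 -
  -- 2cos θ ≤ θ²` is used. With energies at most `η²/80`, each part contributes at most `η²/4`.
  have hpt : ∀ ξ : ℝ, (4 * 1 ^ 2 + ξ ^ 2) ^ σ * (2 - 2 * Real.cos (ξ * y)) ≤
      20 * (ξ ^ 2 * (4 * κ ^ 2 + ξ ^ 2) ^ (σ - 1)) +
        (4 * 1 ^ 2 + κ ^ 2) ^ σ * κ ^ 2 * y ^ 2 := by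
    intro ξ
    have h0 := two_sub_two_mul_cos_nonneg (ξ * y)
    have hA : 0 ≤ 20 * (ξ ^ 2 * (4 * κ ^ 2 + ξ ^ 2) ^ (σ - 1)) := by positivity
    have hB : 0 ≤ (4 * 1 ^ 2 + κ ^ 2) ^ σ * κ ^ 2 * y ^ 2 := by positivity
    rcases le_total (κ ^ 2) (ξ ^ 2) with hξ | hξ
    · refine le_trans ?_ (le_add_of_nonneg_right hB)
      have h1 : (4 * 1 ^ 2 + ξ ^ 2) ^ σ ≤ (4 * κ ^ 2 + ξ ^ 2) ^ σ :=
        Real.rpow_le_rpow (by positivity) (by nlinarith) hσ₀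
      have h2 : (4 * κ ^ 2 + ξ ^ 2) ^ σ =
          (4 * κ ^ 2 + ξ ^ 2) ^ (σ - 1) * (4 * κ ^ 2 + ξ ^ 2) := by
        rw [← Real.rpow_add_one (by positivity), sub_add_cancel]
      have h3 : 0 ≤ (4 * κ ^ 2 + ξ ^ 2) ^ (σ - 1) := by positivity
      calc _ ≤ (4 * κ ^ 2 + ξ ^ 2) ^ (σ - 1) * (4 * κ ^ 2 + ξ ^ 2) * 4 :=
            mul_le_mul (h1.trans h2.le) (two_sub_two_mul_cos_le _) h0 (by positivity)
        _ ≤ (4 * κ ^ 2 + ξ ^ 2) ^ (σ - 1) * (5 * ξ ^ 2) * 4 := by gcongr; linarith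
        _ = _ := by ring
    · refine le_trans ?_ (le_add_of_nonneg_left hA)
      have h1 : 2 - 2 * Real.cos (ξ * y) ≤ κ ^ 2 * y ^ 2 := by
        have := Real.one_sub_sq_div_two_le_cos (x := ξ * y)
        nlinarith [mul_le_mul_of_nonneg_right hξ (sq_nonneg y)]
      rw [mul_assoc ((4 * 1 ^ 2 + κ ^ 2) ^ σ)]
      gcongr
  refine lt_of_pow_lt_pow_left₀ 2 hη.le ?_
  rw [sobolevNorm_shift_sq]
  have hi := (integrable_derivEnergy hσ hκ f).const_mul 20
  have hj := (integrable_norm_fourierHat_sq f).const_mul ((4 * 1 ^ 2 + κ ^ 2) ^ σ * κ ^ 2 * y ^ 2)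
  have hle : ∫ ξ, (4 * 1 ^ 2 + ξ ^ 2) ^ σ * (2 - 2 * Real.cos (ξ * y)) * ‖fourierHat f ξ‖ ^ 2 ≤
      20 * derivEnergy σ κ f + (4 * 1 ^ 2 + κ ^ 2) ^ σ * κ ^ 2 * y ^ 2 * l2Norm f ^ 2 := by
    rw [← integral_norm_fourierHat_sq, derivEnergy, ← integral_const_mul, ← integral_const_mul,
      ← integral_add hi hj]
    refine integral_mono (integrable_shift hσ f y) (hi.add hj) fun ξ => ?_
    refine (mul_le_mul_of_nonneg_right (hpt ξ) (by positivity)).trans (le_of_eq ?_)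
    ring
  have h1 : (4 * 1 ^ 2 + κ ^ 2) ^ σ * κ ^ 2 * y ^ 2 * l2Norm f ^ 2 ≤ D * y ^ 2 := by
    have := pow_le_pow_left₀ (l2Norm_nonneg f) (hM f hf) 2
    calc _ ≤ (4 * 1 ^ 2 + κ ^ 2) ^ σ * κ ^ 2 * y ^ 2 * M ^ 2 := by gcongr
      _ = _ := by rw [hD]; ring
  have h2 : D * y ^ 2 ≤ η ^ 2 / 4 := by
    have h3 : y ^ 2 ≤ (η / (2 * (D + 1))) ^ 2 := by
      rw [← sq_abs y]
      exact pow_le_pow_left₀ (abs_nonneg y) hy.le 2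
    calc _ ≤ D * (η / (2 * (D + 1))) ^ 2 := by gcongr
      _ = η ^ 2 / 4 * (D / (D + 1) ^ 2) := by field_simp; ring
      _ ≤ η ^ 2 / 4 * 1 := by
          gcongr
          rw [div_le_one (by positivity)]
          nlinarith
      _ = _ := mul_one _
  have h3 := hκQ f hf
  have h4 : 0 < η ^ 2 := by positivity
  linarith

theorem integral_two_sub_two_mul_cos {ξ : ℝ} (hξ : ξ ≠ 0) (r : ℝ) :
    ∫ y in (0 : ℝ)..r, (2 - 2 * Real.cos (ξ * y)) = 2 * r - 2 * (Real.sin (ξ * r) / ξ) := by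
  have h : ∀ y ∈ Set.uIcc 0 r, HasDerivAt (fun y => 2 * y - 2 * (Real.sin (ξ * y) / ξ))
      (2 - 2 * Real.cos (ξ * y)) y := fun y _ => by
    have h1 := ((((hasDerivAt_id y).const_mul ξ).sin.div_const ξ).const_mul 2)
    refine (((hasDerivAt_id y).const_mul 2).sub h1).congr_deriv ?_
    simp only [id_eq]
    field_simp
  rw [intervalIntegral.integral_eq_sub_of_hasDerivAt h
    (Continuous.intervalIntegrable (by fun_prop) _ _)]
  simp

/-- The oscillating part of the integral is at most `2/|ξ| ≤ r`, half of the main term `2r`. Hence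
translations detect all frequencies above `2/r` on average. -/
theorem le_lintegral_two_sub_two_mul_cos {ξ r : ℝ} (hr : 0 < r) (hξ : 2 / r ≤ |ξ|) :
    ENNReal.ofReal r ≤ ∫⁻ y in Set.Ioc 0 r, ENNReal.ofReal (2 - 2 * Real.cos (ξ * y)) := by
  have hξ0 : 0 < |ξ| := lt_of_lt_of_le (by positivity) hξ
  have hne : ξ ≠ 0 := abs_pos.1 hξ0
  have hi : IntegrableOn (fun y => 2 - 2 * Real.cos (ξ * y)) (Set.Ioc 0 r) :=
    (intervalIntegrable_iff_integrableOn_Ioc_of_le hr.le).1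
      (Continuous.intervalIntegrable (by fun_prop) _ _)
  rw [← ofReal_integral_eq_lintegral_ofReal hi
    (Eventually.of_forall fun y => two_sub_two_mul_cos_nonneg _),
    ← intervalIntegral.integral_of_le hr.le, integral_two_sub_two_mul_cos hne]
  refine ENNReal.ofReal_le_ofReal ?_
  have h1 : |Real.sin (ξ * r) / ξ| ≤ r / 2 := by
    rw [abs_div, div_le_iff₀ hξ0]
    rw [div_le_iff₀ hr] at hξ
    nlinarith [Real.abs_sin_le_one (ξ * r)]
  linarith [(abs_le.1 h1).2]

theorem sq_mul_rpow_le_of_abs_le {σ κ ξ N : ℝ} (hσ : σ ≤ 1) (hκ : 1 ≤ κ) (hξ : |ξ| ≤ N) :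
    ξ ^ 2 * (4 * κ ^ 2 + ξ ^ 2) ^ (σ - 1) ≤ N ^ 2 * (4 * κ ^ 2) ^ (σ - 1) := by
  have h1 : ξ ^ 2 ≤ N ^ 2 := by
    rw [← sq_abs ξ]
    exact pow_le_pow_left₀ (abs_nonneg ξ) hξ 2
  have h2 : (4 * κ ^ 2 + ξ ^ 2) ^ (σ - 1) ≤ (4 * κ ^ 2) ^ (σ - 1) :=
    Real.rpow_le_rpow_of_nonpos (by positivity) (by nlinarith [sq_nonneg ξ]) (by linarith)
  gcongr

theorem sq_mul_rpow_le_rpow {σ κ ξ : ℝ} (hσ₀ : 0 ≤ σ) (hσ : σ ≤ 1) (hξ : ξ ≠ 0) :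
    ξ ^ 2 * (4 * κ ^ 2 + ξ ^ 2) ^ (σ - 1) ≤ (4 * 1 ^ 2 + ξ ^ 2) ^ σ := by
  have h0 : 0 < ξ ^ 2 := by positivity
  calc _ ≤ ξ ^ 2 * (ξ ^ 2) ^ (σ - 1) := by
        gcongr 1
        exact Real.rpow_le_rpow_of_nonpos h0 (by nlinarith [sq_nonneg κ]) (by linarith)
    _ = (ξ ^ 2) ^ σ := by
        rw [mul_comm, ← Real.rpow_add_one h0.ne', sub_add_cancel]
    _ ≤ _ := Real.rpow_le_rpow h0.le (by linarith) hσ₀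

/-- The energy is controlled by averages of translation differences. -/
theorem derivEnergy_le_of_shift {σ κ r A : ℝ} (hσ₀ : 0 ≤ σ) (hσ : σ ≤ 1) (hκ : 1 ≤ κ)
    (hr : 0 < r) (hA : 0 ≤ A) (f : 𝓢(ℝ, ℂ))
    (h : ∀ y ∈ Set.Ioc 0 r, sobolevNorm σ 1 (fun x => f (x + y) - f x) ^ 2 ≤ A) :
    derivEnergy σ κ f ≤ (2 / r) ^ 2 * (4 * κ ^ 2) ^ (σ - 1) * l2Norm f ^ 2 + A := by
  have hf := (continuous_fourierHat f).measurable
  set G : ℝ → ℝ := fun ξ => (4 * 1 ^ 2 + ξ ^ 2) ^ σ * ‖fourierHat f ξ‖ ^ 2 with hG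
  set I : ℝ → ENNReal := fun ξ =>
    ∫⁻ y in Set.Ioc 0 r, ENNReal.ofReal (2 - 2 * Real.cos (ξ * y)) with hI
  have hGm : Measurable G := by fun_prop
  have hsum : ∫⁻ ξ, ENNReal.ofReal (G ξ) * I ξ ≤ ENNReal.ofReal A * ENNReal.ofReal r := by
    have h1 : ∀ y ∈ Set.Ioc 0 r, ∫⁻ ξ, ENNReal.ofReal (G ξ) *
        ENNReal.ofReal (2 - 2 * Real.cos (ξ * y)) ≤ ENNReal.ofReal A := by
      intro y hy
      refine le_trans (le_of_eq ?_) (ENNReal.ofReal_le_ofReal (h y hy))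
      rw [sobolevNorm_shift_sq, ofReal_integral_eq_lintegral_ofReal (integrable_shift hσ f y)
        (Eventually.of_forall fun ξ => mul_nonneg (mul_nonneg (by positivity)
          (two_sub_two_mul_cos_nonneg _)) (by positivity))]
      refine lintegral_congr fun ξ => ?_
      rw [← ENNReal.ofReal_mul (by positivity)]
      congr 1
      simp only [hG]
      ring
    have h2 := setLIntegral_mono' (μ := volume) measurableSet_Ioc h1
    rw [setLIntegral_const, Real.volume_Ioc, sub_zero, lintegral_lintegral_swap] at h2
    · refine le_trans (le_of_eq (lintegral_congr fun ξ => ?_)) h2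
      rw [lintegral_const_mul' _ _ ENNReal.ofReal_ne_top]
    · exact Measurable.aemeasurable (by fun_prop)
  -- Frequencies below `2/r` are damped by `(4κ²)^{σ-1}`, which decays as `κ → ∞`; those above are
  -- bounded by the average of the translation differences over `(0, r]`.
  have hpt : ∀ ξ, ENNReal.ofReal
      (ξ ^ 2 * (4 * κ ^ 2 + ξ ^ 2) ^ (σ - 1) * ‖fourierHat f ξ‖ ^ 2) ≤
      ENNReal.ofReal ((2 / r) ^ 2 * (4 * κ ^ 2) ^ (σ - 1) * ‖fourierHat f ξ‖ ^ 2) +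
        ENNReal.ofReal r⁻¹ * (ENNReal.ofReal (G ξ) * I ξ) := by
    intro ξ
    rcases le_total |ξ| (2 / r) with hξ | hξ
    · refine le_add_right (ENNReal.ofReal_le_ofReal ?_)
      exact mul_le_mul_of_nonneg_right (sq_mul_rpow_le_of_abs_le hσ hκ hξ) (by positivity)
    · refine le_add_left ?_
      have hne : ξ ≠ 0 := abs_pos.1 (lt_of_lt_of_le (by positivity) hξ)
      calc _ ≤ ENNReal.ofReal (G ξ) := ENNReal.ofReal_le_ofReal
            (mul_le_mul_of_nonneg_right (sq_mul_rpow_le_rpow hσ₀ hσ hne) (by positivity))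
        _ = ENNReal.ofReal r⁻¹ * (ENNReal.ofReal (G ξ) * ENNReal.ofReal r) := by
            rw [← ENNReal.ofReal_mul (by positivity), ← ENNReal.ofReal_mul (by positivity)]
            congr 1
            field_simp
        _ ≤ _ := by
            gcongr
            exact le_lintegral_two_sub_two_mul_cos hr hξ
  have hfin : ENNReal.ofReal (derivEnergy σ κ f) ≤
      ENNReal.ofReal ((2 / r) ^ 2 * (4 * κ ^ 2) ^ (σ - 1) * l2Norm f ^ 2 + A) := by
    rw [derivEnergy, ofReal_integral_eq_lintegral_ofReal (integrable_derivEnergy hσ hκ f)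
      (Eventually.of_forall fun ξ => by positivity)]
    refine (lintegral_mono hpt).trans ?_
    rw [lintegral_add_left (by fun_prop), lintegral_const_mul' _ _ ENNReal.ofReal_ne_top,
      ENNReal.ofReal_add (by positivity) hA]
    refine add_le_add (le_of_eq ?_) ?_
    · rw [← integral_norm_fourierHat_sq, ← integral_const_mul, ofReal_integral_eq_lintegral_ofReal
        ((integrable_norm_fourierHat_sq f).const_mul _)
        (Eventually.of_forall fun ξ => by positivity)]
    · calc _ ≤ ENNReal.ofReal r⁻¹ * (ENNReal.ofReal A * ENNReal.ofReal r) := by gcongr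
        _ = ENNReal.ofReal A := by
          rw [← ENNReal.ofReal_mul hA, ← ENNReal.ofReal_mul (by positivity)]
          congr 1
          field_simp
  exact (ENNReal.ofReal_le_ofReal_iff (by positivity)).1 hfin

/-- Equicontinuous sets have uniformly small high-frequency energy. -/
theorem EquicontinuousInSobolev.eventually_derivEnergy_le {σ M : ℝ} (hσ₀ : 0 ≤ σ) (hσ : σ < 1)
    {Q : Set 𝓢(ℝ, ℂ)} (hM : ∀ f ∈ Q, l2Norm f ≤ M) (h : EquicontinuousInSobolev σ Q)
    {η : ℝ} (hη : 0 < η) : ∀ᶠ κ : ℝ in atTop, ∀ f ∈ Q, derivEnergy σ κ f ≤ η := by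
  obtain ⟨r, hr, hQ⟩ := h (Real.sqrt (η / 2)) (Real.sqrt_pos.2 (by positivity))
  have hlim : Tendsto (fun κ : ℝ => (2 / (r / 2)) ^ 2 * (4 * κ ^ 2) ^ (σ - 1) * M ^ 2)
      atTop (𝓝 0) := by
    have h1 : Tendsto (fun κ : ℝ => 4 * κ ^ 2) atTop atTop :=
      (tendsto_pow_atTop two_ne_zero).const_mul_atTop (by norm_num)
    have h2 := (tendsto_rpow_neg_atTop (y := 1 - σ) (by linarith)).comp h1
    rw [neg_sub] at h2
    simpa using (h2.const_mul ((2 / (r / 2)) ^ 2)).mul_const (M ^ 2)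
  filter_upwards [hlim.eventually_lt_const (show (0 : ℝ) < η / 2 by positivity),
    eventually_ge_atTop 1] with κ hκ1 hκ f hf
  -- Half the radius is taken because the average includes the endpoint, whereas equicontinuity
  -- requires `|y| < r`.
  have h1 := derivEnergy_le_of_shift hσ₀ hσ.le hκ (r := r / 2) (A := η / 2) (by positivity)
    (by positivity) f fun y hy => by
      have h2 := hQ f hf y (by rw [abs_of_pos hy.1]; linarith [hy.2])
      rw [← Real.sq_sqrt (show 0 ≤ η / 2 by positivity)]
      exact pow_le_pow_left₀ (Real.sqrt_nonneg _) h2.le 2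
  have h2 : (2 / (r / 2)) ^ 2 * (4 * κ ^ 2) ^ (σ - 1) * l2Norm f ^ 2 ≤
      (2 / (r / 2)) ^ 2 * (4 * κ ^ 2) ^ (σ - 1) * M ^ 2 := by
    have := pow_le_pow_left₀ (l2Norm_nonneg f) (hM f hf) 2
    gcongr
  linarith

end Equicontinuity

end DispersiveFlows

/-! ### The main theorem -/

theorem proposition8p1 (σ : ℝ) (hσ₀ : 0 ≤ σ) (hσ₁ : σ < 1 / 2) :
    ∃ δ₀ : ℝ, 0 < δ₀ ∧ ∃ C : ℝ, 0 < C ∧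
      (∀ (e : DispersiveFlows.Equation) (ε : ℝ), (ε = 1 ∨ ε = -1) →
        ∀ δ : ℝ, 0 < δ → δ ≤ δ₀ →
        ∀ q : ℝ → 𝓢(ℝ, ℂ), DispersiveFlows.IsSchwartzSolution e ε q →
          DispersiveFlows.l2Norm (q 0) ≤ δ →
          ∀ t κ : ℝ, 1 ≤ κ →
            DispersiveFlows.sobolevNorm (σ - 1) κ (deriv (q t)) ^ 2 ≤
              C * (DispersiveFlows.sobolevNorm (σ - 1) κ (deriv (q 0)) ^ 2 +
                κ ^ (2 * σ - 1) * δ ^ 2 * DispersiveFlows.l2Norm (q 0) ^ 2)) ∧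
      (∀ (e : DispersiveFlows.Equation) (ε : ℝ), (ε = 1 ∨ ε = -1) →
        ∀ Q : Set 𝓢(ℝ, ℂ), (∀ f ∈ Q, DispersiveFlows.l2Norm f ≤ δ₀) →
          DispersiveFlows.EquicontinuousInSobolev σ Q →
          DispersiveFlows.EquicontinuousInSobolev σ (DispersiveFlows.orbits e ε Q)) := by
  obtain ⟨C, hC, hmain⟩ := DispersiveFlows.exists_derivEnergy_le hσ₀ hσ₁
  refine ⟨1 / 2, by norm_num, C, hC, ?_, ?_⟩
  · intro e ε hε δ hδ hδ₀ q hq hs t κ hκ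
    rw [DispersiveFlows.sobolevNorm_deriv_sq, DispersiveFlows.sobolevNorm_deriv_sq]
    refine (hmain e ε hε q hq (hs.trans hδ₀) t κ hκ).trans ?_
    have h1 := pow_le_pow_left₀ (DispersiveFlows.l2Norm_nonneg (q 0)) hs 2
    have h2 : DispersiveFlows.l2Norm (q 0) ^ 4 ≤ δ ^ 2 * DispersiveFlows.l2Norm (q 0) ^ 2 := by
      nlinarith [sq_nonneg (DispersiveFlows.l2Norm (q 0))]
    rw [mul_assoc (κ ^ (2 * σ - 1))]
    gcongr
  · intro e ε hε Q hQ hequi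
    refine DispersiveFlows.equicontinuousInSobolev_of_derivEnergy (M := 1 / 2) hσ₀ (by linarith)
      ?_ ?_
    · rintro f ⟨q, t, hq, hq0, rfl⟩
      rw [hq.l2Norm_eq]
      exact hQ _ hq0
    · intro η hη
      have h1 := hequi.eventually_derivEnergy_le hσ₀ (by linarith) hQ
        (show 0 < η / (2 * C) by positivity)
      have h2 := (tendsto_rpow_neg_atTop (y := 1 - 2 * σ) (by linarith)).eventually_lt_const
        (show (0 : ℝ) < η / (2 * C) by positivity)
      -- One `κ` serves all of `Q`: both the initial energies and `κ^{2σ-1}` are at most `η/(2C)`,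
      -- so (i) bounds every later energy by `η`.
      obtain ⟨κ, hκ1, hκ2, hκ⟩ := (h1.and (h2.and (eventually_ge_atTop 1))).exists
      refine ⟨κ, hκ, ?_⟩
      rintro f ⟨q, t, hq, hq0, rfl⟩
      refine (hmain e ε hε q hq (hQ _ hq0) t κ hκ).trans ?_
      have h3 := hκ1 _ hq0
      rw [neg_sub] at hκ2
      have h4 : DispersiveFlows.l2Norm (q 0) ^ 4 ≤ 1 :=
        pow_le_one₀ (DispersiveFlows.l2Norm_nonneg _) ((hQ _ hq0).trans (by norm_num))
      have h5 : κ ^ (2 * σ - 1) * DispersiveFlows.l2Norm (q 0) ^ 4 ≤ κ ^ (2 * σ - 1) :=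
        mul_le_of_le_one_right (by positivity) h4
      calc _ ≤ C * (η / (2 * C) + η / (2 * C)) := by
            gcongr
            exact h5.trans hκ2.le
        _ = η := by field_simp; ring
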